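/- Let $p$ be a prime number, let $k_0$ be a field of characteristic $p$ and let $S$ be a normal integral scheme which is projective over $k_0$. Write $F_S:S\to S$ for the absolute Frobenius endomorphism of $S$, $F_S^{n,*}$ for the pull-back along its $n$-th iterate, and $\Omega_{F_S}$ for the sheaf of relative differentials of the morphism $F_S$. Let $V$ be an ample vector bundle on $S$ (that is, a locally free sheaf of finite rank such that, for every coherent sheaf $G$ on $S$, the sheaf $G\otimes {\rm Sym}^n(V)$ is generated by its global sections for all sufficiently large $n$), with dual $V^\vee$. Let $n_0\geq 0$ be an integer such that $$H^0(S,F_S^{n,*}(V^\vee)\otimes\Omega_{F_S})=0\quad\text{for all } n>n_0 .$$ Let $S'$ be an irreducible scheme and let $\phi:S'\to S$ be a finite morphism which is generically inseparable, i.e. $\phi$ is dominant and the residue field at the generic point of $S'$ is a purely inseparable (possibly trivial) extension of the function field of $S$. Then the pull-back map $$H^1(S,F_S^{n_0,*}(V^\vee))\to H^1(S',\phi^*(F_S^{n_0,*}(V^\vee)))$$ is injective. -/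

import Mathlib

open CategoryTheory Limits TopologicalSpace Opposite AlgebraicGeometry

universe u

noncomputable section

namespace FrobeniusPullback

variable {X Y : Scheme.{u}}

/-! ### Sheafification, vector bundles, dual -/

/-- The sheaf of `𝒪_X`-modules associated with a presheaf of `𝒪_X`-modules. -/
def sheafify (P : X.PresheafOfModules) : X.Modules :=
  (PresheafOfModules.sheafification (𝟙 X.ringCatSheaf.obj)).obj P

/-- The tensor product `M ⊗ N` of sheaves of `𝒪_X`-modules: the sheafification of
`U ↦ M(U) ⊗ N(U)`. -/
def tensor (M N : X.Modules) : X.Modules :=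
  sheafify (PresheafOfModules.Monoidal.tensorObj (R := X.presheaf) M.val N.val)

/-- A vector bundle: a locally free sheaf of finite rank. -/
def IsVectorBundle (M : X.Modules) : Prop :=
  ∃ q : SheafOfModules.LocalGeneratorsData.{u} (R := X.ringCatSheaf) M,
    q.IsLocallyFreeData ∧ q.IsFiniteType

/-- Sections over `U` of the dual of `M`, i.e. morphisms of sheaves of modules `M|_U ⟶ 𝒪_U`: families
of `𝒪(W)`-linear maps `M(W) → 𝒪(W)`, for `W ⊆ U` open, which are compatible with restriction. -/
def dualSections (M : X.Modules) (U : X.Opens) :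
    AddSubgroup (∀ W : {W : X.Opens // W ≤ U}, Γ(M, W.1) →ₗ[Γ(X, W.1)] Γ(X, W.1)) where
  carrier := {φ | ∀ (W₁ W₂ : X.Opens) (h₁₂ : W₁ ≤ W₂) (h₂ : W₂ ≤ U) (m : Γ(M, W₂)),
    φ ⟨W₁, h₁₂.trans h₂⟩ (M.presheaf.map (homOfLE h₁₂).op m) =
      X.presheaf.map (homOfLE h₁₂).op (φ ⟨W₂, h₂⟩ m)}
  zero_mem' := by intro W₁ W₂ h₁₂ h₂ m; simp
  add_mem' := by
    intro φ ψ hφ hψ W₁ W₂ h₁₂ h₂ m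
    simp [hφ W₁ W₂ h₁₂ h₂ m, hψ W₁ W₂ h₁₂ h₂ m]
  neg_mem' := by
    intro φ hφ W₁ W₂ h₁₂ h₂ m
    simp [hφ W₁ W₂ h₁₂ h₂ m]

instance (M : X.Modules) (U : X.Opens) : Module Γ(X, U) (dualSections M U) where
  smul r φ := ⟨fun W ↦ X.presheaf.map (homOfLE W.2).op r • φ.1 W, by
    intro W₁ W₂ h₁₂ h₂ m
    simp only [LinearMap.smul_apply, smul_eq_mul, map_mul, φ.2 W₁ W₂ h₁₂ h₂ m]
    rw [← CommRingCat.comp_apply, ← Functor.map_comp]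
    rfl⟩
  one_smul φ := by
    refine Subtype.ext (funext fun W ↦ LinearMap.ext fun m ↦ ?_)
    change X.presheaf.map _ 1 * _ = _
    simp
  mul_smul r s φ := by
    refine Subtype.ext (funext fun W ↦ LinearMap.ext fun m ↦ ?_)
    change X.presheaf.map _ (r * s) * _ = _ * (_ * _)
    rw [map_mul, mul_assoc]
  smul_zero r := by
    refine Subtype.ext (funext fun W ↦ LinearMap.ext fun m ↦ ?_)
    exact mul_zero _
  smul_add r φ ψ := by
    refine Subtype.ext (funext fun W ↦ LinearMap.ext fun m ↦ ?_)
    exact mul_add _ _ _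
  add_smul r s φ := by
    refine Subtype.ext (funext fun W ↦ LinearMap.ext fun m ↦ ?_)
    change X.presheaf.map _ (r + s) * _ = _ * _ + _ * _
    rw [map_add, add_mul]
  zero_smul φ := by
    refine Subtype.ext (funext fun W ↦ LinearMap.ext fun m ↦ ?_)
    change X.presheaf.map _ 0 * _ = 0
    rw [map_zero, zero_mul]

/-- Restriction of sections of the dual to a smaller open subset. -/
def dualRestrict (M : X.Modules) {U V : X.Opens} (h : V ≤ U) :
    dualSections M U →+ dualSections M V where
  toFun φ := ⟨fun W ↦ φ.1 ⟨W.1, W.2.trans h⟩, fun W₁ W₂ h₁₂ h₂ m ↦ φ.2 W₁ W₂ h₁₂ (h₂.trans h) m⟩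
  map_zero' := rfl
  map_add' _ _ := rfl

lemma dualRestrict_smul (M : X.Modules) {U V : X.Opens} (h : V ≤ U) (r : Γ(X, U))
    (φ : dualSections M U) :
    dualRestrict M h (r • φ) = X.presheaf.map (homOfLE h).op r • dualRestrict M h φ := by
  refine Subtype.ext (funext fun W ↦ LinearMap.ext fun m ↦ ?_)
  change X.presheaf.map _ r * _ = X.presheaf.map _ (X.presheaf.map _ r) * _
  rw [← CommRingCat.comp_apply, ← Functor.map_comp]
  rfl

/-- The abelian presheaf underlying the dual of `M`. -/
def dualAb (M : X.Modules) : TopCat.Presheaf Ab.{u} X where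
  obj U := AddCommGrpCat.of (dualSections M U.unop)
  map f := AddCommGrpCat.ofHom (dualRestrict M f.unop.le)
  map_id _ := rfl
  map_comp _ _ := rfl

instance (M : X.Modules) (U : X.Opensᵒᵖ) : Module (X.ringCatSheaf.obj.obj U) ((dualAb M).obj U) :=
  inferInstanceAs (Module Γ(X, U.unop) (dualSections M U.unop))

/-- The presheaf of modules underlying the dual of `M`. -/
def dualPresheaf (M : X.Modules) : X.PresheafOfModules :=
  PresheafOfModules.ofPresheaf (R := X.ringCatSheaf.obj) (dualAb M)
    (fun _ _ f r φ ↦ dualRestrict_smul M f.unop.le r φ)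

lemma dualAb_isSheaf (M : X.Modules) : (dualAb M).IsSheaf := by
  rw [TopCat.Presheaf.isSheaf_iff_isSheafUniqueGluing]
  intro ι U sf' hsf'
  let sf : ∀ i, dualSections M (U i) := sf'
  have key : ∀ (i j : ι) (W : X.Opens) (hi : W ≤ U i) (hj : W ≤ U j),
      (sf i).1 ⟨W, hi⟩ = (sf j).1 ⟨W, hj⟩ := by
    intro i j W hi hj
    exact congrFun (congrArg Subtype.val (hsf' i j)) ⟨W, le_inf hi hj⟩
  have hcov : ∀ W : X.Opens, W ≤ iSup U → W ≤ ⨆ i, W ⊓ U i := fun W h ↦ by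
    rw [← inf_iSup_eq]; exact le_inf le_rfl h
  have ex : ∀ (W : X.Opens) (hW : W ≤ iSup U) (m : Γ(M, W)), ∃! s : Γ(X, W),
      ∀ i, X.presheaf.map (homOfLE (inf_le_left : W ⊓ U i ≤ W)).op s =
        (sf i).1 ⟨W ⊓ U i, inf_le_right⟩
          (M.presheaf.map (homOfLE (inf_le_left : W ⊓ U i ≤ W)).op m) := by
    intro W hW m
    refine X.sheaf.existsUnique_gluing' (fun i ↦ W ⊓ U i) W (fun i ↦ homOfLE inf_le_left)
      (hcov W hW) _ ?_
    intro i j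
    have h1 := (sf i).2 (W ⊓ U i ⊓ (W ⊓ U j)) (W ⊓ U i) inf_le_left inf_le_right
      (M.presheaf.map (homOfLE (inf_le_left : W ⊓ U i ≤ W)).op m)
    have h2 := (sf j).2 (W ⊓ U i ⊓ (W ⊓ U j)) (W ⊓ U j) inf_le_right inf_le_right
      (M.presheaf.map (homOfLE (inf_le_left : W ⊓ U j ≤ W)).op m)
    refine h1.symm.trans (Eq.trans ?_ h2)
    rw [key i j _ (inf_le_left.trans inf_le_right) (inf_le_right.trans inf_le_right)]
    congr 1
    rw [← AddCommGrpCat.comp_apply, ← AddCommGrpCat.comp_apply, ← Functor.map_comp,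
      ← Functor.map_comp]
    rfl
  have eq_of : ∀ (W : X.Opens) (hW : W ≤ iSup U) (s t : Γ(X, W)),
      (∀ i, X.presheaf.map (homOfLE (inf_le_left : W ⊓ U i ≤ W)).op s =
        X.presheaf.map (homOfLE (inf_le_left : W ⊓ U i ≤ W)).op t) → s = t := fun W hW s t h ↦
    X.sheaf.eq_of_locally_eq' (fun i ↦ W ⊓ U i) W (fun i ↦ homOfLE inf_le_left) (hcov W hW) s t h
  choose g hg _ using ex
  let φ : ∀ W : {W : X.Opens // W ≤ iSup U}, Γ(M, W.1) →ₗ[Γ(X, W.1)] Γ(X, W.1) := fun ⟨W, hW⟩ ↦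
    { toFun := g W hW
      map_add' := fun a b ↦ eq_of W hW _ _ fun i ↦ by
        rw [map_add, hg, hg, hg, map_add, map_add]
      map_smul' := fun r a ↦ eq_of W hW _ _ fun i ↦ by
        rw [RingHom.id_apply, smul_eq_mul, map_mul, hg, hg, Scheme.Modules.map_smul, map_smul,
          smul_eq_mul] }
  have hφ : ∀ (i : ι) (W : X.Opens) (hW : W ≤ iSup U) (hi : W ≤ U i) (m : Γ(M, W)),
      φ ⟨W, hW⟩ m = (sf i).1 ⟨W, hi⟩ m := by
    intro i W hW hi m
    refine eq_of W hW _ _ fun j ↦ ?_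
    refine (hg W hW m j).trans ?_
    rw [key j i _ inf_le_right (inf_le_left.trans hi)]
    exact (sf i).2 _ _ inf_le_left hi m
  refine ⟨⟨φ, ?_⟩, ?_, ?_⟩
  · intro W₁ W₂ h₁₂ h₂ m
    refine eq_of W₁ (h₁₂.trans h₂) _ _ fun i ↦ ?_
    refine (hg W₁ (h₁₂.trans h₂) _ i).trans ?_
    have h1 := (sf i).2 (W₁ ⊓ U i) (W₂ ⊓ U i) (inf_le_inf_right _ h₁₂) inf_le_right
      (M.presheaf.map (homOfLE (inf_le_left : W₂ ⊓ U i ≤ W₂)).op m)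
    have h2 := hg W₂ h₂ m i
    rw [← h2] at h1
    rw [← CommRingCat.comp_apply, ← Functor.map_comp] at h1 ⊢
    rw [← AddCommGrpCat.comp_apply, ← Functor.map_comp] at h1 ⊢
    exact h1
  · intro i
    refine Subtype.ext (funext fun W ↦ LinearMap.ext fun m ↦ ?_)
    exact hφ i W.1 (W.2.trans (le_iSup U i)) W.2 m
  · intro ψ hψ
    refine Subtype.ext (funext fun W ↦ LinearMap.ext fun m ↦ ?_)
    refine eq_of W.1 W.2 _ _ fun i ↦ ?_
    refine (((ψ : dualSections M (iSup U)).2 (W.1 ⊓ U i) W.1 inf_le_left W.2 m).symm.trans ?_).trans (hg W.1 W.2 m i).symm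
    exact LinearMap.congr_fun (congrFun (congrArg Subtype.val (hψ i)) ⟨W.1 ⊓ U i, inf_le_right⟩) _

/-- The dual `M^∨ = ℋom(M, 𝒪_X)` of a sheaf of modules. -/
def dual (M : X.Modules) : X.Modules where
  val := dualPresheaf M
  isSheaf := dualAb_isSheaf M

/-! ### Symmetric powers and ampleness -/

section
variable {R R' R'' M M' M'' : Type u} [CommRing R] [CommRing R'] [CommRing R'']
  [AddCommGroup M] [AddCommGroup M'] [AddCommGroup M''] [Module R M] [Module R' M'] [Module R'' M'']

/-- The ring homomorphism between symmetric algebras induced by a semilinear map. -/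
def symAlgMap (σ : R →+* R') (g : M →ₛₗ[σ] M') : SymmetricAlgebra R M →+* SymmetricAlgebra R' M' :=
  letI : Algebra R (SymmetricAlgebra R' M') := Algebra.compHom _ σ
  (SymmetricAlgebra.lift (R := R) (M := M) (A := SymmetricAlgebra R' M')
    { toFun := fun m ↦ SymmetricAlgebra.ι R' M' (g m)
      map_add' := fun a b ↦ by rw [map_add, map_add]
      map_smul' := fun r a ↦ by rw [map_smulₛₗ, map_smul]; rfl }).toRingHom

lemma symAlgMap_ι (σ : R →+* R') (g : M →ₛₗ[σ] M') (m : M) :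
    symAlgMap σ g (SymmetricAlgebra.ι R M m) = SymmetricAlgebra.ι R' M' (g m) :=
  letI : Algebra R (SymmetricAlgebra R' M') := Algebra.compHom _ σ
  SymmetricAlgebra.lift_ι_apply _ m

lemma symAlgMap_algebraMap (σ : R →+* R') (g : M →ₛₗ[σ] M') (r : R) :
    symAlgMap σ g (algebraMap R _ r) = algebraMap R' _ (σ r) :=
  letI : Algebra R (SymmetricAlgebra R' M') := Algebra.compHom _ σ
  AlgHom.commutes (SymmetricAlgebra.lift (R := R) (M := M) (A := SymmetricAlgebra R' M') _) r

lemma symAlgMap_smul (σ : R →+* R') (g : M →ₛₗ[σ] M') (r : R) (a : SymmetricAlgebra R M) :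
    symAlgMap σ g (r • a) = σ r • symAlgMap σ g a := by
  rw [Algebra.smul_def, Algebra.smul_def, map_mul, symAlgMap_algebraMap]

lemma symAlgMap_id (g : M →ₗ[R] M) (hg : ∀ m, g m = m) (a : SymmetricAlgebra R M) :
    symAlgMap (RingHom.id R) g a = a := by
  induction a using SymmetricAlgebra.induction with
  | algebraMap r => simp [symAlgMap_algebraMap]
  | ι x => rw [symAlgMap_ι, hg]
  | mul a b ha hb => rw [map_mul, ha, hb]
  | add a b ha hb => rw [map_add, ha, hb]

lemma symAlgMap_congr {σ σ' : R →+* R'} {g : M →ₛₗ[σ] M'} {g' : M →ₛₗ[σ'] M'}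
    (hσ : ∀ r, σ r = σ' r) (hg : ∀ m, g m = g' m) (a : SymmetricAlgebra R M) :
    symAlgMap σ g a = symAlgMap σ' g' a := by
  induction a using SymmetricAlgebra.induction with
  | algebraMap r => simp [symAlgMap_algebraMap, hσ]
  | ι x => rw [symAlgMap_ι, symAlgMap_ι, hg]
  | mul a b ha hb => rw [map_mul, map_mul, ha, hb]
  | add a b ha hb => rw [map_add, map_add, ha, hb]

lemma symAlgMap_comp (σ : R →+* R') (g : M →ₛₗ[σ] M') (τ : R' →+* R'') (h : M' →ₛₗ[τ] M'')
    (ρ : R →+* R'') (k : M →ₛₗ[ρ] M'') (hρ : ∀ r, ρ r = τ (σ r)) (hk : ∀ m, k m = h (g m))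
    (a : SymmetricAlgebra R M) :
    symAlgMap ρ k a = symAlgMap τ h (symAlgMap σ g a) := by
  induction a using SymmetricAlgebra.induction with
  | algebraMap r => simp [symAlgMap_algebraMap, hρ]
  | ι x => rw [symAlgMap_ι, symAlgMap_ι, symAlgMap_ι, hk]
  | mul a b ha hb => simp only [map_mul, ha, hb]
  | add a b ha hb => simp only [map_add, ha, hb]

variable (R M) in
/-- The `n`-th symmetric power of `M`, as the degree `n` part of the symmetric algebra: the span of
the products of `n` elements of `M`. -/
def symPow (n : ℕ) : Submodule R (SymmetricAlgebra R M) :=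
  LinearMap.range (SymmetricAlgebra.ι R M) ^ n

lemma symAlgMap_mem (σ : R →+* R') (g : M →ₛₗ[σ] M') (n : ℕ) {a : SymmetricAlgebra R M}
    (ha : a ∈ symPow R M n) : symAlgMap σ g a ∈ symPow R' M' n := by
  induction ha using Submodule.pow_induction_on_left' with
  | algebraMap r =>
    rw [symAlgMap_algebraMap, symPow, pow_zero]
    exact Submodule.algebraMap_mem _
  | add x y i _ _ hx hy => rw [map_add]; exact add_mem hx hy
  | mem_mul m hm i x _ hx =>
    obtain ⟨m, rfl⟩ := hm
    rw [map_mul, symAlgMap_ι, symPow, pow_succ']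
    exact Submodule.mul_mem_mul ⟨_, rfl⟩ hx

end

/-- Restriction of sections of `M`, as a semilinear map. -/
def restrictₛₗ (M : X.Modules) {U V : X.Opens} (f : V ⟶ U) :
    Γ(M, U) →ₛₗ[(X.presheaf.map f.op).hom] Γ(M, V) where
  toFun m := M.presheaf.map f.op m
  map_add' := map_add _
  map_smul' r m := M.map_smul f r m

/-- Restriction of sections of the symmetric power presheaf. -/
def symRestrict (M : X.Modules) (n : ℕ) {U V : X.Opens} (f : V ⟶ U) :
    symPow Γ(X, U) Γ(M, U) n →+ symPow Γ(X, V) Γ(M, V) n where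
  toFun a := ⟨symAlgMap _ (restrictₛₗ M f) a.1, symAlgMap_mem _ _ n a.2⟩
  map_zero' := Subtype.ext (map_zero _)
  map_add' _ _ := Subtype.ext (map_add _ _ _)

lemma symRestrict_smul (M : X.Modules) (n : ℕ) {U V : X.Opens} (f : V ⟶ U) (r : Γ(X, U))
    (a : symPow Γ(X, U) Γ(M, U) n) :
    symRestrict M n f (r • a) = X.presheaf.map f.op r • symRestrict M n f a :=
  Subtype.ext (symAlgMap_smul _ _ r a.1)

/-- The abelian presheaf `U ↦ Sym^n M(U)`. -/
def symAb (M : X.Modules) (n : ℕ) : TopCat.Presheaf Ab.{u} X where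
  obj U := AddCommGrpCat.of (symPow Γ(X, U.unop) Γ(M, U.unop) n)
  map f := AddCommGrpCat.ofHom (symRestrict M n f.unop)
  map_id U := by
    refine AddCommGrpCat.ext fun a ↦ Subtype.ext ?_
    refine (symAlgMap_congr (σ' := RingHom.id _) (g' := LinearMap.id) (fun r ↦ ?_) (fun m ↦ ?_)
      a.1).trans (symAlgMap_id _ (fun _ ↦ rfl) _)
    · exact CategoryTheory.congr_fun (X.presheaf.map_id U) r
    · exact CategoryTheory.congr_fun (M.presheaf.map_id U) m
  map_comp f g := by
    refine AddCommGrpCat.ext fun a ↦ Subtype.ext ?_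
    refine symAlgMap_comp _ _ _ _ _ _ (fun r ↦ ?_) (fun m ↦ ?_) a.1
    · exact CategoryTheory.congr_fun (X.presheaf.map_comp f g) r
    · exact CategoryTheory.congr_fun (M.presheaf.map_comp f g) m

instance (M : X.Modules) (n : ℕ) (U : X.Opensᵒᵖ) :
    Module (X.ringCatSheaf.obj.obj U) ((symAb M n).obj U) :=
  inferInstanceAs (Module Γ(X, U.unop) (symPow Γ(X, U.unop) Γ(M, U.unop) n))

/-- The presheaf of modules `U ↦ Sym^n M(U)`. -/
def symPresheaf (M : X.Modules) (n : ℕ) : X.PresheafOfModules :=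
  PresheafOfModules.ofPresheaf (R := X.ringCatSheaf.obj) (symAb M n)
    (fun _ _ f r a ↦ symRestrict_smul M n f.unop r a)

/-- The symmetric power `Sym^n M` of a sheaf of modules. -/
def symSheaf (M : X.Modules) (n : ℕ) : X.Modules := sheafify (symPresheaf M n)

/-- `M` is generated by its global sections. -/
def IsGloballyGenerated (M : X.Modules) : Prop :=
  Nonempty (SheafOfModules.GeneratingSections (R := X.ringCatSheaf) M)

/-- Coherent sheaves. On a locally noetherian scheme these are the sheaves of modules which are
locally of finite presentation. -/
def IsCoherent (M : X.Modules) : Prop :=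
  SheafOfModules.IsFinitePresentation (R := X.ringCatSheaf) M

/-- A vector bundle `V` is ample (Hartshorne's definition) if for every coherent sheaf `F` the sheaf
`F ⊗ Sym^n V` is generated by its global sections for all sufficiently large `n`. -/
structure IsAmpleBundle (V : X.Modules) : Prop where
  isVectorBundle : IsVectorBundle V
  isGloballyGenerated : ∀ F : X.Modules, IsCoherent F →
    ∃ n₁ : ℕ, ∀ n : ℕ, n₁ ≤ n → IsGloballyGenerated (tensor F (symSheaf V n))

/-! ### Frobenius and differentials -/

/-- The Frobenius endomorphism `x ↦ x ^ p` of a ring in which `p = 0` (possibly the zero ring). -/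
def frobRingHom (p : ℕ) [Fact p.Prime] (R : Type u) [CommRing R] (h : (p : R) = 0) : R →+* R where
  toFun x := x ^ p
  map_one' := one_pow p
  map_mul' x y := mul_pow x y p
  map_zero' := zero_pow (Fact.out : p.Prime).ne_zero
  map_add' x y := by
    rcases subsingleton_or_nontrivial R with _ | _
    · exact Subsingleton.elim _ _
    · have : CharP R p := (CharP.charP_iff_prime_eq_zero Fact.out).mpr h
      exact add_pow_char x y p

lemma natCast_section (p : ℕ) (h : (p : Γ(X, ⊤)) = 0) (U : X.Opens) : (p : Γ(X, U)) = 0 := by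
  have := congrArg (X.presheaf.map (homOfLE (le_top : U ≤ ⊤)).op) h
  rwa [map_natCast, map_zero] at this

/-- The absolute Frobenius endomorphism `F_X` of a scheme `X` on which `p = 0`: the identity on the
underlying space and `x ↦ x ^ p` on functions. -/
def absoluteFrobenius (p : ℕ) [Fact p.Prime] (X : Scheme.{u}) (h : (p : Γ(X, ⊤)) = 0) : X ⟶ X where
  base := 𝟙 _
  c :=
    { app := fun U ↦ CommRingCat.ofHom (frobRingHom p Γ(X, U.unop) (natCast_section p h U.unop))
      naturality := fun U V f ↦ by
        ext x
        exact (map_pow (X.presheaf.map f).hom x p).symm }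
  prop x := by
    refine ⟨fun a ha ↦ ?_⟩
    obtain ⟨U, hx, s, rfl⟩ := X.presheaf.exists_germ_eq a
    rw [PresheafedSpace.stalkMap_germ_apply] at ha
    change IsUnit (X.presheaf.germ U x hx (s ^ p)) at ha
    rw [map_pow] at ha
    exact (isUnit_pow_iff (Fact.out : p.Prime).ne_zero).mp ha

lemma natCast_eq_zero_of_hom (p : ℕ) {k : Type u} [Field k] [CharP k p] (π : X ⟶ Spec (.of k)) :
    (p : Γ(X, ⊤)) = 0 := by
  let σ : k →+* Γ(X, ⊤) := ((Scheme.ΓSpecIso (.of k)).inv ≫ π.appTop).hom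
  rw [← map_natCast σ p, CharP.cast_eq_zero k p, map_zero]

/-- The `n`-th iterate `F_X^n` of the absolute Frobenius endomorphism. -/
def iteratedFrobenius (p : ℕ) [Fact p.Prime] (X : Scheme.{u}) (h : (p : Γ(X, ⊤)) = 0) :
    ℕ → (X ⟶ X)
  | 0 => 𝟙 X
  | n + 1 => iteratedFrobenius p X h n ≫ absoluteFrobenius p X h

/-- The sheaf of relative differentials `Ω_f` of a morphism `f : X ⟶ Y`: the sheafification of
`U ↦ Ω_{𝒪_X(U) / (f⁻¹𝒪_Y)(U)}`, where `f⁻¹𝒪_Y` is the presheaf inverse image. -/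
def relativeDifferentials (f : X ⟶ Y) : X.Modules :=
  sheafify (PresheafOfModules.DifferentialsConstruction.relativeDifferentials'
    (((TopCat.Presheaf.pullbackPushforwardAdjunction CommRingCat.{u} f.base).homEquiv _ _).symm
      f.c))

/-! ### Cohomology and pull-back -/

/-- Sheaves of abelian groups on (the Zariski site of) a scheme. -/
abbrev AbSheaf (X : Scheme.{u}) : Type (u + 1) :=
  Sheaf (Opens.grothendieckTopology X) AddCommGrpCat.{u}

/-- The sheaf of abelian groups underlying a sheaf of modules. -/
def toAbSheaf (M : X.Modules) : AbSheaf X := ⟨M.presheaf, M.isSheaf⟩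

/-- The cohomology groups `H^n(X, M)` of a sheaf of modules. -/
abbrev Cohomology (M : X.Modules) (n : ℕ) : Type u := Sheaf.H.{u} (toAbSheaf M) n

/-- The inverse image functor `f⁻¹` on abelian sheaves. -/
def inverseImage (f : X ⟶ Y) : AbSheaf Y ⥤ AbSheaf X :=
  (Opens.map f.base).sheafPullback AddCommGrpCat.{u} (Opens.grothendieckTopology Y)
    (Opens.grothendieckTopology X)

/-- The direct image functor `f_*` on abelian sheaves. -/
def directImage (f : X ⟶ Y) : AbSheaf X ⥤ AbSheaf Y :=
  (Opens.map f.base).sheafPushforwardContinuous AddCommGrpCat.{u} (Opens.grothendieckTopology Y)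
    (Opens.grothendieckTopology X)

/-- The adjunction between `f⁻¹` and `f_*`. -/
def inverseImageAdj (f : X ⟶ Y) : inverseImage f ⊣ directImage f :=
  (Opens.map f.base).sheafAdjunctionContinuous _ _ _

instance (f : X ⟶ Y) : PreservesFiniteLimits (inverseImage f) := by
  unfold inverseImage
  apply Functor.SmallCategories.instPreservesFiniteLimitsSheafSheafPullbackOfRepresentablyFlat

instance (f : X ⟶ Y) : PreservesFiniteColimits (inverseImage f) :=
  have := (inverseImageAdj f).leftAdjoint_preservesColimits
  inferInstance

instance (f : X ⟶ Y) : (inverseImage f).Additive :=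
  have := preservesBinaryBiproducts_of_preservesBinaryProducts (inverseImage f)
  Functor.additive_of_preservesBinaryBiproducts _

/-- The constant sheaf `ℤ_X`. -/
def constantZ (X : Scheme.{u}) : AbSheaf X :=
  (constantSheaf (Opens.grothendieckTopology X) AddCommGrpCat.{u}).obj
    (AddCommGrpCat.of (ULift ℤ))

/-- The canonical morphism `ℤ_X ⟶ f⁻¹ ℤ_Y` of abelian sheaves. -/
def constComparison (f : X ⟶ Y) : constantZ X ⟶ (inverseImage f).obj (constantZ Y) :=
  ((constantSheafAdj (Opens.grothendieckTopology X) AddCommGrpCat.{u}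
    (isTerminalTop : IsTerminal (⊤ : X.Opens))).homEquiv _ _).symm
    ((constantSheafAdj (Opens.grothendieckTopology Y) AddCommGrpCat.{u}
      (isTerminalTop : IsTerminal (⊤ : Y.Opens))).homEquiv _ _
      ((inverseImageAdj f).unit.app (constantZ Y)))

/-- The canonical morphism of abelian sheaves `f⁻¹ M ⟶ f^* M`. -/
def inverseImageToPullback (f : X ⟶ Y) (M : Y.Modules) :
    (inverseImage f).obj (toAbSheaf M) ⟶ toAbSheaf ((Scheme.Modules.pullback f).obj M) :=
  ((inverseImageAdj f).homEquiv _ _).symm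
    ⟨((Scheme.Modules.pullbackPushforwardAdjunction f).unit.app M).mapPresheaf⟩

/-- The pull-back map `H^n(Y, M) → H^n(X, f^* M)`: the composition of the map
`H^n(Y, M) = Ext^n(ℤ_Y, M) → Ext^n(ℤ_X, f⁻¹ M) = H^n(X, f⁻¹ M)` given by the exact functor `f⁻¹`, with
the map induced by `f⁻¹ M ⟶ f^* M`. -/
def cohomologyPullback (f : X ⟶ Y) (M : Y.Modules) (n : ℕ) :
    Cohomology M n →+ Cohomology ((Scheme.Modules.pullback f).obj M) n :=
  ((Sheaf.H.map (inverseImageToPullback f M) n).comp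
    ((Abelian.Ext.mk₀ (constComparison f)).precomp
      ((inverseImage f).obj (toAbSheaf M)) (zero_add n))).comp
    (Functor.mapExtAddHom (inverseImage f) _ _ n)

/-! ### Projective, normal, generically inseparable -/

section ProjectiveSpace

attribute [local instance] MvPolynomial.gradedAlgebra

/-- Projective space of dimension `n` over a field. -/
def projectiveSpace (k : Type u) [Field k] (n : ℕ) : Scheme.{u} :=
  Proj (MvPolynomial.homogeneousSubmodule (Fin (n + 1)) k)

/-- The structure morphism of projective space. -/
def projectiveSpaceToSpec (k : Type u) [Field k] (n : ℕ) :
    projectiveSpace k n ⟶ Spec (.of k) :=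
  Proj.toSpecZero (MvPolynomial.homogeneousSubmodule (Fin (n + 1)) k) ≫
    Spec.map (CommRingCat.ofHom (algebraMap k _))

end ProjectiveSpace

/-- A scheme over a field is projective if it is isomorphic over this field to a closed subscheme of
a projective space. -/
def IsProjectiveOver {k : Type u} [Field k] (π : X ⟶ Spec (.of k)) : Prop :=
  ∃ (n : ℕ) (i : X ⟶ projectiveSpace k n), IsClosedImmersion i ∧ i ≫ projectiveSpaceToSpec k n = π

/-- A scheme is normal if its local rings are integrally closed domains. -/
def IsNormalScheme (X : Scheme.{u}) : Prop :=
  ∀ x : X, IsDomain (X.presheaf.stalk x) ∧ IsIntegrallyClosed (X.presheaf.stalk x)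

/-- A morphism `φ : X ⟶ Y`, where `X` is irreducible, is generically inseparable if it is dominant
and if the extension of residue fields at the generic points is purely inseparable. -/
structure IsGenericallyInseparable (φ : X ⟶ Y) [IrreducibleSpace X] : Prop where
  isDominant : IsDominant φ
  isPurelyInseparable :
    letI := (φ.residueFieldMap (genericPoint X)).hom.toAlgebra
    IsPurelyInseparable (Y.residueField (φ (genericPoint X))) (X.residueField (genericPoint X))

end FrobeniusPullback

end

open FrobeniusPullback

noncomputable section

namespace FrobeniusPullback

open Abelian

/-! ### Extension classes and left exact adjoints -/

section Ext

universe v w w'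

variable {C : Type*} [Category.{v} C] [Abelian C] {D : Type*} [Category.{v} D] [Abelian D]

/-! Write `F` for the absolute Frobenius of `S` and `M` for the pull-back of `dual V` along its
`n₀`-th iterate. A class in `H¹(S, M) = Ext¹(ℤ_S, M)` is represented by an extension `0 → M → E →
ℤ_S → 0` of abelian sheaves. If its pull-back along a morphism `f` vanishes, the long exact `Ext`
sequence and the adjunction between inverse and direct image show that the unit `M → f_* f^* M`
extends to `E`; this is the property `UnitExtends`. For `f = 𝟙` it is a retraction of `M → E`, so
the class is zero. The whole argument therefore moves `UnitExtends` from `φ` to the identity.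

The first move goes up: `UnitExtends` passes to composites `g ≫ φ`, and
`exists_comp_eq_iteratedFrobenius` provides `g : S ⟶ S'` such that `g ≫ φ` is an iterate of
Frobenius. Indeed, since `φ` is finite and generically inseparable, a fixed `p ^ N`-th power of
every function on `S'` has its generic value in the function field of `S`, and normality of `S`
makes that value a regular function. So the power map goes from functions on `S'` to functions on
`S`. It also shows that `φ` is a homeomorphism, which yields `g`.

The second move goes down, one Frobenius at a time (`UnitExtends.of_frobenius_comp`). Let `P` be the
pull-back of `M` along the `k`-th iterate, and let `h` be an extension to `E` of the unit for the
`(k+1)`-st. The canonical connection on `F^* P` (`exists_connection`) kills pulled-back sections, so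
its composite with `h` kills `M` and factors through `ℤ_S`. It is thus given by a global section of
`F^* P ⊗ Ω_F`, which vanishes by assumption. Hence `h` takes horizontal values, and by Cartier's
theorem (`exists_pb_eq`) these are pull-backs of unique sections of `P`, so `h` descends. Cartier's
theorem rests on `exists_derivation_ne_zero`, that derivations detect `p`-th powers in a field, and
again on normality. -/

/-- Every class in `Ext¹(Z, M)` is the class of an extension of `Z` by `M`. -/
lemma exists_extClass_eq [HasExt.{w} C] [EnoughInjectives C] {Z M : C} (c : Ext.{w} Z M 1) :
    ∃ (E : C) (i : M ⟶ E) (q : E ⟶ Z) (hz : i ≫ q = 0)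
      (hS : (ShortComplex.mk i q hz).ShortExact), hS.extClass = c := by
  let S₀ : ShortComplex C := .mk (Injective.ι M) (cokernel.π (Injective.ι M)) (cokernel.condition _)
  have hS₀ : S₀.ShortExact :=
    { exact := ShortComplex.exact_cokernel _
      mono_f := by dsimp [S₀]; infer_instance
      epi_g := by dsimp [S₀]; infer_instance }
  -- `Ext¹` into an injective object vanishes, so `c` is the connecting image of a morphism `q` from
  -- `Z` to the cokernel; the required extension is the pull-back of `S₀` along `q`.
  obtain ⟨q, hq⟩ := Ext.covariant_sequence_exact₁ Z hS₀ c (Ext.eq_zero_of_injective _) (zero_add 1)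
  obtain ⟨q, rfl⟩ := (Ext.mk₀_bijective _ _).2 q
  let i : M ⟶ pullback S₀.g q := pullback.lift S₀.f 0 (by simp)
  have hz : i ≫ pullback.snd S₀.g q = 0 := pullback.lift_snd _ _ _
  let S : ShortComplex C := .mk i (pullback.snd S₀.g q) hz
  have : Epi S₀.g := hS₀.epi_g
  have : Mono S₀.f := hS₀.mono_f
  have hi : i ≫ pullback.fst S₀.g q = S₀.f := pullback.lift_fst _ _ _
  have hS : S.ShortExact :=
    have : Mono i := mono_of_mono_fac hi
    { exact := by
        refine ShortComplex.exact_of_f_is_kernel _ (KernelFork.IsLimit.ofι' i hz fun {A} k hk ↦ ?_)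
        have h0 : (k ≫ pullback.fst S₀.g q) ≫ S₀.g = 0 := by
          rw [Category.assoc, pullback.condition, ← Category.assoc, hk, zero_comp]
        refine ⟨hS₀.exact.lift _ h0, pullback.hom_ext ?_ ?_⟩
        · rw [Category.assoc, hi, hS₀.exact.lift_f]
        · rw [Category.assoc, hz, comp_zero, hk]
      mono_f := this
      epi_g := by dsimp [S]; infer_instance }
  refine ⟨_, _, _, hz, hS, ?_⟩
  let φ : S ⟶ S₀ := { τ₁ := 𝟙 _, τ₂ := pullback.fst S₀.g q, τ₃ := q
                      comm₁₂ := by simp [S, hi, S₀], comm₂₃ := pullback.condition }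
  have := Ext.comp_mk₀_id hS.extClass
  rw [← hq, ← this]
  exact ShortComplex.ShortExact.extClass_naturality hS hS₀ φ

/-- An extension class which is killed by a left exact functor `L` followed by the push-out along
`a : L M ⟶ N` is one for which the adjoint of `a` extends to the extension. -/
lemma exists_extend_of_mapExt_eq_zero [HasExt.{w} C] [HasExt.{w'} D] {L : C ⥤ D} {R : D ⥤ C}
    (adj : L ⊣ R) [L.Additive] [PreservesFiniteLimits L] [PreservesFiniteColimits L]
    {S : ShortComplex C} (hS : S.ShortExact) {Z' : D} (z : Z' ⟶ L.obj S.X₃) [IsIso z] {N : D}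
    (a : L.obj S.X₁ ⟶ N)
    (h : ((Ext.mk₀ z).comp (hS.extClass.mapExactFunctor L) (zero_add 1)).comp
      (Ext.mk₀ a) (add_zero 1) = 0) :
    ∃ k : S.X₂ ⟶ R.obj N, S.f ≫ k = adj.homEquiv _ _ a := by
  rw [Ext.comp_assoc_of_third_deg_zero] at h
  have h' : (hS.map_of_exact L).extClass.comp (Ext.mk₀ a) (add_zero 1) = 0 := by
    have := congrArg (fun e ↦ (Ext.mk₀ (inv z)).comp e (zero_add 1)) h
    simp only [Ext.mk₀_comp_mk₀_assoc, IsIso.inv_hom_id, Ext.mk₀_id_comp, Ext.comp_zero] at this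
    exact (congrArg (fun e : Ext (L.obj S.X₃) (L.obj S.X₁) 1 ↦ e.comp (Ext.mk₀ a) (add_zero 1))
      (Ext.mapExactFunctor_extClass L hS)).symm.trans this
  -- The vanishing of the pushed-out class means that `a` extends over `L.obj S.X₂`; the adjoint of
  -- this extension is the witness.
  obtain ⟨k, hk⟩ := Ext.contravariant_sequence_exact₁ (hS.map_of_exact L) _ _ (add_zero 1) h'
  obtain ⟨k, rfl⟩ := (Ext.mk₀_bijective _ _).2 k
  rw [Ext.mk₀_comp_mk₀] at hk
  have hk' := (Ext.mk₀_bijective _ _).1 hk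
  exact ⟨adj.homEquiv _ _ k, (adj.homEquiv_naturality_left S.f k).symm.trans (congrArg _ hk')⟩

/-- The class equals its composite with `S.f ≫ r`, and composing an extension class with `S.f`
already gives zero. -/
lemma extClass_eq_zero_of_retraction [HasExt.{w} C] {S : ShortComplex C} (hS : S.ShortExact)
    (r : S.X₂ ⟶ S.X₁) (hr : S.f ≫ r = 𝟙 _) : hS.extClass = 0 := by
  have h := Ext.comp_mk₀_id hS.extClass
  rw [← hr, ← Ext.mk₀_comp_mk₀, ← Ext.comp_assoc_of_third_deg_zero, hS.extClass_comp,
    Ext.zero_comp] at h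
  exact h.symm

end Ext

/-! ### Vanishing of a pulled-back class as extension of the unit -/

variable {X Y Z : Scheme.{u}}

/-- By Yoneda: morphisms to `G` from either side are the global sections of `G`, because `f⁻¹(Y) =
X`, and `constComparison` is compatible with these identifications. -/
instance isIso_constComparison (f : X ⟶ Y) : IsIso (constComparison f) := by
  rw [isIso_iff_coyoneda_map_bijective]
  intro G
  let aX := constantSheafAdj (Opens.grothendieckTopology X) AddCommGrpCat.{u}
    (isTerminalTop : IsTerminal (⊤ : X.Opens))
  let aY := constantSheafAdj (Opens.grothendieckTopology Y) AddCommGrpCat.{u}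
      (isTerminalTop : IsTerminal (⊤ : Y.Opens))
  have key : ∀ k : (inverseImage f).obj (constantZ Y) ⟶ G,
      aX.homEquiv _ _ (constComparison f ≫ k) =
        aY.homEquiv _ _ ((inverseImageAdj f).homEquiv _ _ k) := by
    intro k
    refine (aX.homEquiv_naturality_right (constComparison f) k).trans ?_
    refine Eq.trans (congrArg (· ≫ _) ((aX.homEquiv _ _).apply_symm_apply _)) ?_
    refine Eq.trans ?_ (congrArg _ ((inverseImageAdj f).homEquiv_unit ..).symm)
    exact (aY.homEquiv_naturality_right ((inverseImageAdj f).unit.app (constantZ Y))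
      ((directImage f).map k)).symm
  have : (fun k : (inverseImage f).obj (constantZ Y) ⟶ G ↦ constComparison f ≫ k) =
      (aX.homEquiv _ _).symm ∘ (aY.homEquiv _ _) ∘ ((inverseImageAdj f).homEquiv _ _) := by
    funext k
    simp only [Function.comp]
    exact (((aX.homEquiv _ _).symm_apply_apply _).symm.trans
      (congrArg (aX.homEquiv _ _).symm (key k)))
  rw [this]
  exact (Equiv.bijective _).comp ((Equiv.bijective _).comp (Equiv.bijective _))

/-- The canonical morphism `M ⟶ f_* f^* M` of abelian sheaves. -/
def unitAb (f : X ⟶ Y) (M : Y.Modules) :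
    toAbSheaf M ⟶ (directImage f).obj (toAbSheaf ((Scheme.Modules.pullback f).obj M)) :=
  ⟨((Scheme.Modules.pullbackPushforwardAdjunction f).unit.app M).mapPresheaf⟩

/-- `M ⟶ f_* f^* M` extends along `i : M ⟶ E`. -/
def UnitExtends (f : X ⟶ Y) {M : Y.Modules} {E : AbSheaf Y} (i : toAbSheaf M ⟶ E) : Prop :=
  ∃ h : E ⟶ (directImage f).obj (toAbSheaf ((Scheme.Modules.pullback f).obj M)), i ≫ h = unitAb f M

lemma unitExtends_of_cohomologyPullback_eq_zero (f : X ⟶ Y) (M : Y.Modules)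
    {E : AbSheaf Y} (i : toAbSheaf M ⟶ E) (q : E ⟶ constantZ Y) (hz : i ≫ q = 0)
    (hS : (ShortComplex.mk i q hz).ShortExact)
    (h : cohomologyPullback f M 1 hS.extClass = 0) : UnitExtends f i := by
  obtain ⟨k, hk⟩ := exists_extend_of_mapExt_eq_zero (inverseImageAdj f) hS (constComparison f)
    (inverseImageToPullback f M) h
  refine ⟨k, hk.trans ?_⟩
  rw [inverseImageToPullback, Equiv.apply_symm_apply]
  rfl

/-- The morphism of abelian sheaves underlying a morphism of sheaves of modules. -/
def mapAb {M N : X.Modules} (a : M ⟶ N) : toAbSheaf M ⟶ toAbSheaf N := ⟨a.mapPresheaf⟩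

lemma mapAb_id (M : X.Modules) : mapAb (𝟙 M) = 𝟙 _ := rfl

lemma mapAb_comp {M N K : X.Modules} (a : M ⟶ N) (b : N ⟶ K) :
    mapAb (a ≫ b) = mapAb a ≫ mapAb b := rfl

/-- The isomorphism `pullbackComp` is the mate of `pushforwardComp`, so it intertwines the unit of
the composite adjunction with the unit for `f ≫ g`. -/
lemma unit_comp_pullbackComp_inv (f : X ⟶ Y) (g : Y ⟶ Z) (M : Z.Modules) :
    (Scheme.Modules.pullbackPushforwardAdjunction (f ≫ g)).unit.app M ≫
      (Scheme.Modules.pushforward (f ≫ g)).map ((Scheme.Modules.pullbackComp f g).inv.app M) =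
    ((Scheme.Modules.pullbackPushforwardAdjunction g).unit.app M ≫
      (Scheme.Modules.pushforward g).map ((Scheme.Modules.pullbackPushforwardAdjunction f).unit.app
        ((Scheme.Modules.pullback g).obj M))) ≫ (Scheme.Modules.pushforwardComp f g).hom.app _ := by
  have h := unit_conjugateEquiv
    ((Scheme.Modules.pullbackPushforwardAdjunction g).comp
      (Scheme.Modules.pullbackPushforwardAdjunction f))
    (Scheme.Modules.pullbackPushforwardAdjunction (f ≫ g))
    (Scheme.Modules.pullbackComp f g).inv M
  rw [Scheme.Modules.conjugateEquiv_pullbackComp_inv] at h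
  refine h.symm.trans ?_
  congr 1

lemma unitAb_comp (f : X ⟶ Y) (g : Y ⟶ Z) (M : Z.Modules) :
    unitAb (f ≫ g) M ≫
      (directImage (f ≫ g)).map (mapAb ((Scheme.Modules.pullbackComp f g).inv.app M)) =
    (unitAb g M ≫ (directImage g).map (unitAb f ((Scheme.Modules.pullback g).obj M)) :
      toAbSheaf M ⟶ (directImage g).obj ((directImage f).obj _)) := by
  refine (congrArg mapAb (unit_comp_pullbackComp_inv f g M)).trans ?_
  ext U
  rfl

/-- Replaces pull-back along a composite by an iterated pull-back, the form in which Frobenius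
factors can be added or removed one at a time. -/
lemma unitExtends_comp_iff (f : X ⟶ Y) (g : Y ⟶ Z) {M : Z.Modules} {E : AbSheaf Z}
    (i : toAbSheaf M ⟶ E) : UnitExtends (f ≫ g) i ↔
      ∃ h : E ⟶ (directImage g).obj ((directImage f).obj (toAbSheaf
        ((Scheme.Modules.pullback f).obj ((Scheme.Modules.pullback g).obj M)))),
        i ≫ h = unitAb g M ≫ (directImage g).map (unitAb f ((Scheme.Modules.pullback g).obj M)) := by
  constructor
  · rintro ⟨h, hh⟩
    refine ⟨h ≫ (directImage (f ≫ g)).map (mapAb ((Scheme.Modules.pullbackComp f g).inv.app M)), ?_⟩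
    rw [← unitAb_comp, ← hh]
    exact (Category.assoc _ _ _).symm
  · rintro ⟨h, hh⟩
    refine ⟨h ≫ (directImage (f ≫ g)).map (mapAb ((Scheme.Modules.pullbackComp f g).hom.app M)), ?_⟩
    refine (Category.assoc _ _ _).symm.trans ((congrArg (· ≫ _) hh).trans ?_)
    have key : (directImage (f ≫ g)).map (mapAb ((Scheme.Modules.pullbackComp f g).inv.app M)) ≫
        (directImage (f ≫ g)).map (mapAb ((Scheme.Modules.pullbackComp f g).hom.app M)) = 𝟙 _ := by
      rw [← Functor.map_comp, ← mapAb_comp, Iso.inv_hom_id_app, mapAb_id, CategoryTheory.Functor.map_id]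
    refine (congrArg (· ≫ _) (unitAb_comp f g M).symm).trans ?_
    exact (Category.assoc _ _ _).trans ((congrArg (_ ≫ ·) key).trans (Category.comp_id _))

lemma UnitExtends.comp (f : X ⟶ Y) {g : Y ⟶ Z} {M : Z.Modules} {E : AbSheaf Z}
    {i : toAbSheaf M ⟶ E} (hg : UnitExtends g i) : UnitExtends (f ≫ g) i := by
  rw [unitExtends_comp_iff]
  obtain ⟨h, hh⟩ := hg
  exact ⟨h ≫ (directImage g).map (unitAb f _), by rw [← hh, Category.assoc]⟩

/-- Under the isomorphism of `(𝟙 X)^* M` with `M` the unit becomes the identity of `M`, so an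
extension of the unit is a retraction. -/
lemma UnitExtends.exists_retraction {M : X.Modules} {E : AbSheaf X} {i : toAbSheaf M ⟶ E}
    (h : UnitExtends (𝟙 X) i) : ∃ r, i ≫ r = 𝟙 _ := by
  obtain ⟨h, hh⟩ := h
  refine ⟨h ≫ (directImage (𝟙 X)).map (mapAb ((Scheme.Modules.pullbackId X).hom.app M)), ?_⟩
  have h1 := unit_conjugateEquiv Adjunction.id
    (Scheme.Modules.pullbackPushforwardAdjunction (𝟙 X)) (Scheme.Modules.pullbackId X).hom M
  rw [Scheme.Modules.conjugateEquiv_pullbackId_hom] at h1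
  refine (Category.assoc _ _ _).symm.trans ((congrArg (· ≫ _) hh).trans ?_)
  refine (congrArg mapAb h1.symm).trans ?_
  ext U
  rfl

/-! ### Restriction of sections -/

/-- Restriction of functions. -/
def rs {U V : X.Opens} (h : V ≤ U) : Γ(X, U) →+* Γ(X, V) := (X.presheaf.map (homOfLE h).op).hom

/-- Restriction of sections of a sheaf of modules. -/
def rm (M : X.Modules) {U V : X.Opens} (h : V ≤ U) : Γ(M, U) →ₛₗ[rs h] Γ(M, V) :=
  restrictₛₗ M (homOfLE h)

lemma rs_rs {U V W : X.Opens} (h : V ≤ U) (h' : W ≤ V) (a : Γ(X, U)) :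
    rs h' (rs h a) = rs (h'.trans h) a :=
  (ConcreteCategory.congr_hom (X.presheaf.map_comp (homOfLE h).op (homOfLE h').op) a).symm

lemma rs_self {U : X.Opens} (a : Γ(X, U)) : rs le_rfl a = a :=
  ConcreteCategory.congr_hom (X.presheaf.map_id (op U)) a

lemma rm_rm (M : X.Modules) {U V W : X.Opens} (h : V ≤ U) (h' : W ≤ V) (a : Γ(M, U)) :
    rm M h' (rm M h a) = rm M (h'.trans h) a :=
  (ConcreteCategory.congr_hom (M.presheaf.map_comp (homOfLE h).op (homOfLE h').op) a).symm

lemma rm_self (M : X.Modules) {U : X.Opens} (a : Γ(M, U)) : rm M le_rfl a = a :=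
  ConcreteCategory.congr_hom (M.presheaf.map_id (op U)) a

lemma app_rm {M N : X.Modules} (a : M ⟶ N) {U V : X.Opens} (h : V ≤ U) (m : Γ(M, U)) :
    a.app V (rm M h m) = rm N h (a.app U m) :=
  ConcreteCategory.congr_hom (a.mapPresheaf.naturality (homOfLE h).op) m

/-! ### Bases of sheaves of modules -/

section Basis

variable (M : X.Modules) {ι : Type*} [Fintype ι] {U : X.Opens} (e : ι → Γ(M, U))

/-- The linear combinations of the restrictions of sections `e i`. -/
def combination {W : X.Opens} (h : W ≤ U) : (ι → Γ(X, W)) →ₗ[Γ(X, W)] Γ(M, W) :=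
  Fintype.linearCombination Γ(X, W) (fun i ↦ rm M h (e i))

lemma combination_apply {W : X.Opens} (h : W ≤ U) (a : ι → Γ(X, W)) :
    combination M e h a = ∑ i, a i • rm M h (e i) := rfl

lemma rm_combination {W W' : X.Opens} (h : W ≤ U) (h' : W' ≤ W) (a : ι → Γ(X, W)) :
    rm M h' (combination M e h a) = combination M e (h'.trans h) (fun i ↦ rs h' (a i)) := by
  simp only [combination_apply, map_sum, map_smulₛₗ, rm_rm]

/-- The sections `e i` of `M` over `U` form a basis of the restriction of `M` to `U`. -/
def IsBasisOn : Prop :=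
  ∀ (W : X.Opens) (h : W ≤ U), Function.Bijective (combination M e h)

variable {M e} (he : IsBasisOn M e)

/-- The coefficients of a section with respect to a basis. -/
def IsBasisOn.coeff {W : X.Opens} (h : W ≤ U) : Γ(M, W) →ₗ[Γ(X, W)] (ι → Γ(X, W)) :=
  (LinearEquiv.ofBijective _ (he W h)).symm

lemma IsBasisOn.combination_coeff {W : X.Opens} (h : W ≤ U) (m : Γ(M, W)) :
    combination M e h (he.coeff h m) = m :=
  (LinearEquiv.ofBijective _ (he W h)).apply_symm_apply m

lemma IsBasisOn.coeff_combination {W : X.Opens} (h : W ≤ U) (a : ι → Γ(X, W)) :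
    he.coeff h (combination M e h a) = a :=
  (LinearEquiv.ofBijective _ (he W h)).symm_apply_apply a

lemma IsBasisOn.coeff_rm {W W' : X.Opens} (h : W ≤ U) (h' : W' ≤ W) (m : Γ(M, W)) :
    he.coeff (h'.trans h) (rm M h' m) = fun i ↦ rs h' (he.coeff h m i) := by
  apply (he W' (h'.trans h)).1
  exact (he.combination_coeff (h'.trans h) _).trans
    ((congrArg _ (he.combination_coeff h m)).symm.trans (rm_combination M e h h' _))

lemma IsBasisOn.coeff_basis [DecidableEq ι] {W : X.Opens} (h : W ≤ U) (i : ι) :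
    he.coeff h (rm M h (e i)) = Pi.single i 1 := by
  apply (he W h).1
  rw [he.combination_coeff, combination, Fintype.linearCombination_apply_single, one_smul]

lemma isBasisOn_of_coeff (c : ∀ (W : X.Opens), W ≤ U → Γ(M, W) → ι → Γ(X, W))
    (h₁ : ∀ W h a, c W h (combination M e h a) = a)
    (h₂ : ∀ W h m, combination M e h (c W h m) = m) : IsBasisOn M e :=
  fun W h ↦ ⟨Function.LeftInverse.injective (h₁ W h), Function.RightInverse.surjective (h₂ W h)⟩

end Basis

/-! ### Dual bases -/

section Dual

variable {M : X.Modules} {ι : Type*} [Fintype ι] {U : X.Opens} {e : ι → Γ(M, U)}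
  (he : IsBasisOn M e)

/-- The dual basis. -/
def IsBasisOn.dualBasis (i : ι) : Γ(dual M, U) :=
  (⟨fun W ↦ LinearMap.proj i ∘ₗ he.coeff W.2, fun _ _ h₁₂ h₂ m ↦
    congrFun (he.coeff_rm h₂ h₁₂ m) i⟩ : dualSections M U)

/-- The coordinates of a functional are its values on the `e i`; compatibility with restriction
makes these values over `W` determine it over every smaller open set. -/
lemma IsBasisOn.dual : IsBasisOn (dual M) he.dualBasis := by
  classical
  have key (W : X.Opens) (h : W ≤ U) (a : ι → Γ(X, W)) (W' : X.Opens) (h' : W' ≤ W) (m : Γ(M, W')) :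
      (combination (FrobeniusPullback.dual M) he.dualBasis h a : dualSections M W).1 ⟨W', h'⟩ m =
        ∑ i, rs h' (a i) * he.coeff (h'.trans h) m i := by
    let Φ : dualSections M W →+ Γ(X, W') :=
      { toFun := fun φ ↦ φ.1 ⟨W', h'⟩ m
        map_zero' := rfl
        map_add' := fun _ _ ↦ rfl }
    exact map_sum Φ _ _
  refine isBasisOn_of_coeff (fun W h φ i ↦ (φ : dualSections M W).1 ⟨W, le_rfl⟩ (rm M h (e i)))
    (fun W h a ↦ ?_) (fun W h φ ↦ ?_)
  · funext i
    rw [key W h a W le_rfl, Finset.sum_eq_single i]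
    · rw [rs_self, he.coeff_basis, Pi.single_eq_same, mul_one]
    · intro j _ hj
      rw [he.coeff_basis, Pi.single_eq_of_ne hj, mul_zero]
    · simp
  · refine Subtype.ext (funext fun ⟨W', h'⟩ ↦ LinearMap.ext fun m ↦ ?_)
    refine (key W h _ W' h' m).trans ?_
    have hφ := fun i ↦ (φ : dualSections M W).2 W' W h' le_rfl (rm M h (e i))
    conv_rhs => rw [← he.combination_coeff (h'.trans h) m, combination_apply, map_sum]
    refine Finset.sum_congr rfl fun i _ ↦ ?_
    rw [map_smul, smul_eq_mul, mul_comm, ← rm_rm M h h']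
    exact congrArg _ (hφ i).symm

end Dual

/-! ### Local freeness of vector bundles -/

/-- `M` is locally free of finite rank. -/
def IsLocallyFree (M : X.Modules) : Prop :=
  ∀ x : X, ∃ (U : X.Opens) (_ : x ∈ U) (n : ℕ) (e : Fin n → Γ(M, U)), IsBasisOn M e

section Free

universe v₁ u₁
variable {C : Type u₁} [Category.{v₁} C] {J : GrothendieckTopology C}
  {R : Sheaf J RingCat.{u}} [HasSheafify J AddCommGrpCat.{u}]
  [J.WEqualsLocallyBijective AddCommGrpCat.{u}]

open SheafOfModules in
lemma free_hom_ext {I : Type u} {N : SheafOfModules.{u} R} {a b : free I ⟶ N}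
    (h : ∀ i, ιFree i ≫ a = ιFree i ≫ b) : a = b :=
  Cofan.IsColimit.hom_ext (isColimitFreeCofan I) _ _ h

-- A finite coproduct of copies of the unit is also a product. Recording this by morphisms `e`, `c`
-- and their relations lets the basis property be read off after evaluation on sections.
open SheafOfModules in
lemma exists_basis_of_iso_free {I : Type u} [Fintype I] [DecidableEq I] {N : SheafOfModules.{u} R}
    (f : free I ⟶ N) [IsIso f] :
    ∃ (e : I → (unit R ⟶ N)) (c : I → (N ⟶ unit R)),
      (∀ i j, e i ≫ c j = if i = j then 𝟙 _ else 0) ∧ ∑ i, c i ≫ e i = 𝟙 N := by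
  let p (j : I) : free I ⟶ unit R :=
    Cofan.IsColimit.desc (isColimitFreeCofan I) (fun i ↦ if i = j then 𝟙 _ else 0)
  have hp (i j : I) : ιFree i ≫ p j = if i = j then 𝟙 _ else 0 :=
    Cofan.IsColimit.fac (isColimitFreeCofan I) _ i
  refine ⟨fun i ↦ ιFree i ≫ f, fun j ↦ inv f ≫ p j, fun i j ↦ ?_, ?_⟩
  · simp [hp]
  · rw [← cancel_epi f, ← cancel_mono (inv f)]
    refine free_hom_ext fun i ↦ ?_
    simp only [Preadditive.comp_sum, Preadditive.sum_comp, Category.assoc,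
      IsIso.hom_inv_id_assoc, IsIso.hom_inv_id, Category.comp_id]
    simp only [← Category.assoc, hp]
    rw [Finset.sum_eq_single i]
    · simp
    · intro j _ hj; simp [hj.symm]
    · simp

end Free

lemma IsVectorBundle.isLocallyFree {M : X.Modules} (hM : IsVectorBundle M) : IsLocallyFree M := by
  obtain ⟨q, h₁, h₂⟩ := hM
  intro x
  obtain ⟨V, f, ⟨i, ⟨hi⟩⟩, hx⟩ := q.coversTop ⊤ x trivial
  have := h₂.isFiniteType i
  have := h₁.isIso i
  have : Finite (q.generators i).I := inferInstance
  have := Fintype.ofFinite (q.generators i).I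
  classical
  obtain ⟨e, c, hec, hce⟩ := exists_basis_of_iso_free (q.generators i).π
  let U : X.Opens := q.X i
  -- On the slice site over `U`, the object `𝟙 U` is terminal; a morphism from the unit is
  -- determined by the image of `1` there.
  let ee (j) : Γ(M, U) := (e j).val.app (op (Over.mk (𝟙 U))) (1 : Γ(X, U))
  have he (W : X.Opens) (h : W ≤ U) (j) (a : Γ(X, W)) :
      (e j).val.app (op (Over.mk (homOfLE h))) a = (a • rm M h (ee j) : Γ(M, W)) := by
    have h1 : (e j).val.app (op (Over.mk (homOfLE h))) (1 : Γ(X, W)) = rm M h (ee j) := by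
      let r : Over.mk (homOfLE h) ⟶ Over.mk (𝟙 U) := Over.homMk (homOfLE h)
      have := PresheafOfModules.naturality_apply (e j).val r.op (1 : Γ(X, U))
      refine Eq.trans ?_ this
      refine congrArg _ ?_
      exact (map_one (rs h)).symm
    have h2 := ((e j).val.app (op (Over.mk (homOfLE h)))).hom.map_smul a (1 : Γ(X, W))
    rw [← h1]
    refine Eq.trans ?_ h2
    exact congrArg _ (mul_one a).symm
  let cc (W : X.Opens) (h : W ≤ U) (m : Γ(M, W)) (j) : Γ(X, W) :=
    (c j).val.app (op (Over.mk (homOfLE h))) m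
  have hb : IsBasisOn M ee := by
    refine isBasisOn_of_coeff cc (fun W h a ↦ ?_) (fun W h m ↦ ?_)
    · funext j
      have h1 : cc W h (combination M ee h a) j = ∑ i, cc W h (a i • rm M h (ee i)) j :=
        map_sum ((c j).val.app (op (Over.mk (homOfLE h)))).hom _ _
      rw [h1, Finset.sum_eq_single j]
      · rw [← he]
        have := congrArg (fun k ↦ (k.val.app (op (Over.mk (homOfLE h)))).hom (a j)) (hec j j)
        rw [if_pos rfl] at this
        exact this
      · intro i _ hij
        rw [← he]
        have := congrArg (fun k ↦ (k.val.app (op (Over.mk (homOfLE h)))).hom (a i)) (hec i j)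
        rw [if_neg hij] at this
        exact this
      · simp
    · rw [combination_apply]
      simp only [← he]
      let Φ : (M.over (q.X i) ⟶ M.over (q.X i)) →+ Γ(M, W) :=
        { toFun := fun k ↦ (k.val.app (op (Over.mk (homOfLE h)))).hom m
          map_zero' := rfl
          map_add' := fun _ _ ↦ rfl }
      exact (map_sum Φ _ _).symm.trans (congrArg Φ hce)
  let E := (Fintype.equivFin (q.generators i).I).symm
  refine ⟨U, hi.le hx, _, ee ∘ E, isBasisOn_of_coeff (fun W h m j ↦ hb.coeff h m (E j))
    (fun W h a ↦ ?_) (fun W h m ↦ ?_)⟩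
  · have : combination M (ee ∘ E) h a = combination M ee h (a ∘ E.symm) := by
      rw [combination_apply, combination_apply, ← E.sum_comp]
      simp
    rw [this, hb.coeff_combination]
    simp
  · rw [combination_apply]
    exact (E.sum_comp (fun j ↦ hb.coeff h m j • rm M h (ee j))).trans (hb.combination_coeff h m)

lemma IsLocallyFree.dual {M : X.Modules} (hM : IsLocallyFree M) : IsLocallyFree (dual M) :=
  fun x ↦ let ⟨U, hx, n, _, he⟩ := hM x; ⟨U, hx, n, _, he.dual⟩

/-! ### Constructing sheaves of modules and morphisms from sections -/

/-- The data of a sheaf of modules, given by its sections. -/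
structure ModuleData (X : Scheme.{u}) where
  /-- the sections -/
  sec : X.Opens → Type u
  [addCommGroup : ∀ U, AddCommGroup (sec U)]
  [module : ∀ U, Module Γ(X, U) (sec U)]
  /-- the restriction maps -/
  res {U V : X.Opens} (h : V ≤ U) : sec U →+ sec V
  res_self {U : X.Opens} (s : sec U) : res le_rfl s = s
  res_res {U V W : X.Opens} (h : V ≤ U) (h' : W ≤ V) (s : sec U) :
    res h' (res h s) = res (h'.trans h) s
  res_smul {U V : X.Opens} (h : V ≤ U) (a : Γ(X, U)) (s : sec U) : res h (a • s) = rs h a • res h s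
  existsUnique_glue {ι : Type u} (U : ι → X.Opens) (s : ∀ i, sec (U i))
    (hs : ∀ i j, res (inf_le_left : U i ⊓ U j ≤ U i) (s i) = res inf_le_right (s j)) :
    ∃! t : sec (iSup U), ∀ i, res (le_iSup U i) t = s i

namespace ModuleData

attribute [instance] addCommGroup module

variable (T : ModuleData X)

/-- The underlying abelian presheaf. -/
def ab : TopCat.Presheaf Ab.{u} X where
  obj U := AddCommGrpCat.of (T.sec U.unop)
  map f := AddCommGrpCat.ofHom (T.res f.unop.le)
  map_id U := by
    ext s
    exact T.res_self s
  map_comp f g := by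
    ext s
    exact (T.res_res f.unop.le g.unop.le s).symm

instance (U : X.Opensᵒᵖ) : Module (X.ringCatSheaf.obj.obj U) (T.ab.obj U) :=
  inferInstanceAs (Module Γ(X, U.unop) (T.sec U.unop))

/-- The sheaf of modules associated with the data of its sections. -/
def toModules : X.Modules where
  val := PresheafOfModules.ofPresheaf (R := X.ringCatSheaf.obj) T.ab
    (fun _ _ f a s ↦ T.res_smul f.unop.le a s)
  isSheaf := by
    change T.ab.IsSheaf
    rw [TopCat.Presheaf.isSheaf_iff_isSheafUniqueGluing]
    exact fun _ U s hs ↦ T.existsUnique_glue U s hs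

end ModuleData

/-- A morphism of sheaves of modules from its action on sections. -/
def homMk {M N : X.Modules} (a : ∀ U : X.Opens, Γ(M, U) →ₗ[Γ(X, U)] Γ(N, U))
    (ha : ∀ (U V : X.Opens) (h : V ≤ U) (m : Γ(M, U)), a V (rm M h m) = rm N h (a U m)) :
    M ⟶ N :=
  ⟨{ app := fun U ↦ ModuleCat.ofHom (a U.unop)
     naturality := fun f ↦ by
       ext m
       exact ha _ _ f.unop.le m }⟩

/-! ### Universal property of the pull-back in terms of sections -/

section Pullback

variable (f : X ⟶ Y) (M : Y.Modules)

/-- The pull-back of sections. -/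
def pb (W : Y.Opens) : Γ(M, W) →ₛₗ[(f.app W).hom] Γ((Scheme.Modules.pullback f).obj M, f ⁻¹ᵁ W) where
  toFun m := ((Scheme.Modules.pullbackPushforwardAdjunction f).unit.app M).app W m
  map_add' := map_add _
  map_smul' a m := Scheme.Modules.Hom.app_smul
    ((Scheme.Modules.pullbackPushforwardAdjunction f).unit.app M) a m

lemma rs_app {W W' : Y.Opens} (h : W' ≤ W) (a : Γ(Y, W)) :
    rs (f.preimage_mono h) (f.app W a) = f.app W' (rs h a) :=
  (ConcreteCategory.congr_hom (f.naturality (homOfLE h).op) a).symm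

lemma pb_rm {W W' : Y.Opens} (h : W' ≤ W) (m : Γ(M, W)) :
    pb f M W' (rm M h m) = rm _ (f.preimage_mono h) (pb f M W m) :=
  app_rm ((Scheme.Modules.pullbackPushforwardAdjunction f).unit.app M) h m

variable {M}

/-- This is the injectivity half of the adjunction with push-forward. With `exists_pullback_hom` it
is the only access to `f^* M` that is needed, so no formula for its sections over opens not of the
form `f ⁻¹ᵁ W` ever appears. -/
lemma pullback_hom_ext {N : X.Modules} {a b : (Scheme.Modules.pullback f).obj M ⟶ N}
    (h : ∀ W m, a.app (f ⁻¹ᵁ W) (pb f M W m) = b.app (f ⁻¹ᵁ W) (pb f M W m)) : a = b := by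
  apply ((Scheme.Modules.pullbackPushforwardAdjunction f).homEquiv _ _).injective
  rw [Adjunction.homEquiv_unit, Adjunction.homEquiv_unit]
  refine Scheme.Modules.hom_ext _ _ fun W ↦ ?_
  ext m
  exact h W m

lemma exists_pullback_hom {N : X.Modules}
    (t : ∀ W : Y.Opens, Γ(M, W) →ₛₗ[(f.app W).hom] Γ(N, f ⁻¹ᵁ W))
    (ht : ∀ (W W' : Y.Opens) (h : W' ≤ W) (m : Γ(M, W)),
      t W' (rm M h m) = rm N (f.preimage_mono h) (t W m)) :
    ∃ a : (Scheme.Modules.pullback f).obj M ⟶ N, ∀ W m, a.app (f ⁻¹ᵁ W) (pb f M W m) = t W m := by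
  let τ : M ⟶ (Scheme.Modules.pushforward f).obj N :=
    homMk (fun W ↦ { toFun := t W, map_add' := map_add _, map_smul' := fun a m ↦ (t W).map_smulₛₗ a m })
      ht
  refine ⟨((Scheme.Modules.pullbackPushforwardAdjunction f).homEquiv _ _).symm τ, fun W m ↦ ?_⟩
  have := ((Scheme.Modules.pullbackPushforwardAdjunction f).homEquiv M N).apply_symm_apply τ
  rw [Adjunction.homEquiv_unit] at this
  exact congrArg (fun k ↦ (Scheme.Modules.Hom.app k W) m) this

end Pullback

/-! ### Sections with support conditions -/

lemma existsUnique_glue (N : X.Modules) {ι : Type u} (U : ι → X.Opens) (V : X.Opens)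
    (hU : ∀ i, U i ≤ V) (hV : V ≤ iSup U) (s : ∀ i, Γ(N, U i))
    (hs : ∀ i j, rm N (inf_le_left : U i ⊓ U j ≤ U i) (s i) = rm N inf_le_right (s j)) :
    ∃! t : Γ(N, V), ∀ i, rm N (hU i) t = s i :=
  TopCat.Sheaf.existsUnique_gluing' ⟨N.presheaf, N.isSheaf⟩ U V (fun i ↦ homOfLE (hU i)) hV s hs

lemma eq_of_locally_eq (N : X.Modules) {ι : Type u} (U : ι → X.Opens) (V : X.Opens)
    (hU : ∀ i, U i ≤ V) (hV : V ≤ iSup U) (s t : Γ(N, V))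
    (h : ∀ i, rm N (hU i) s = rm N (hU i) t) : s = t :=
  TopCat.Sheaf.eq_of_locally_eq' ⟨N.presheaf, N.isSheaf⟩ U V (fun i ↦ homOfLE (hU i)) hV s t h

/-- The data of the sheaf `W ↦ N(W ∩ V)`. -/
def localizeData (V : X.Opens) (N : X.Modules) : ModuleData X where
  sec W := Γ(N, W ⊓ V)
  module W := Module.compHom _ (rs (inf_le_left : W ⊓ V ≤ W))
  res h := (rm N (inf_le_inf_right V h)).toAddMonoidHom
  res_self s := rm_self N s
  res_res h h' s := rm_rm N _ _ s
  res_smul {U W} h a s := by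
    refine ((rm N (inf_le_inf_right V h)).map_smulₛₗ (rs inf_le_left a) s).trans ?_
    refine congrArg (· • rm N (inf_le_inf_right V h) s) ?_
    exact (rs_rs _ _ _).trans (rs_rs h (inf_le_left : W ⊓ V ≤ W) a).symm
  existsUnique_glue {ι} U s hs := by
    refine existsUnique_glue N (fun i ↦ U i ⊓ V) (iSup U ⊓ V)
      (fun i ↦ inf_le_inf_right V (le_iSup U i)) (by rw [iSup_inf_eq]) s fun i j ↦ ?_
    have h1 : U i ⊓ V ⊓ (U j ⊓ V) ≤ U i ⊓ U j ⊓ V :=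
      le_inf (inf_le_inf inf_le_left inf_le_left) (inf_le_left.trans inf_le_right)
    have := congrArg (rm N h1) (hs i j)
    exact (rm_rm N _ _ _).symm.trans (this.trans (rm_rm N _ _ _))

/-- The sheaf `W ↦ N(W ∩ V)`. -/
def localize (V : X.Opens) (N : X.Modules) : X.Modules := (localizeData V N).toModules

/-- The sections of `localize V N`. -/
def locSec (V : X.Opens) (N : X.Modules) (W : X.Opens) : Γ(localize V N, W) ≃+ Γ(N, W ⊓ V) :=
  AddEquiv.refl _

lemma locSec_smul (V : X.Opens) (N : X.Modules) (W : X.Opens) (a : Γ(X, W))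
    (s : Γ(localize V N, W)) : locSec V N W (a • s) = rs (inf_le_left : W ⊓ V ≤ W) a • locSec V N W s := rfl

/-- The structure sheaf as a sheaf of modules over itself. -/
def structureSheaf (X : Scheme.{u}) : X.Modules := SheafOfModules.unit X.ringCatSheaf

/-- The sections of `localize V 𝒪_X`. -/
def locFun (V W : X.Opens) : Γ(localize V (structureSheaf X), W) ≃+ Γ(X, W ⊓ V) :=
  AddEquiv.refl _

lemma locFun_smul (V W : X.Opens) (a : Γ(X, W))
    (s : Γ(localize V (structureSheaf X), W)) :
    locFun V W (a • s) = rs inf_le_left a * locFun V W s := rfl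

lemma locFun_rm (V : X.Opens) {W W' : X.Opens} (h : W' ≤ W)
    (s : Γ(localize V (structureSheaf X), W)) :
    locFun V W' (rm _ h s) = rs (inf_le_inf_right V h) (locFun V W s) := rfl

/-- Restriction as a morphism `N ⟶ localize V N`. -/
def toLocalize (V : X.Opens) (N : X.Modules) : N ⟶ localize V N :=
  homMk (fun W ↦
    { toFun := fun x ↦ (locSec V N W).symm (rm N inf_le_left x)
      map_add' := fun x y ↦ by rw [map_add, map_add]
      map_smul' := fun a x ↦ (rm N (inf_le_left : W ⊓ V ≤ W)).map_smulₛₗ a x })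
    (fun U W h m ↦ (rm_rm N _ _ _).trans (rm_rm N _ (inf_le_inf_right V h) m).symm)

/-- The linear combination of given sections over `V` with coefficients in `localize V 𝒪_X`. -/
def localCombination {V : X.Opens} {N P : X.Modules} {ι : Type*} [Fintype ι]
    (ε : ι → (P ⟶ localize V (structureSheaf X))) (s : ι → Γ(N, V)) : P ⟶ localize V N :=
  homMk (fun W ↦
    { toFun := fun x ↦ (locSec V N W).symm
        (combination N s inf_le_right fun i ↦ locFun V W ((ε i).app W x))
      map_add' := fun x y ↦ by
        rw [← map_add, ← map_add]
        congr 2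
        funext i
        rw [map_add, map_add]; rfl
      map_smul' := fun a x ↦ by
        apply (locSec V N W).injective
        rw [RingHom.id_apply, locSec_smul, AddEquiv.apply_symm_apply, AddEquiv.apply_symm_apply,
          ← map_smul]
        congr 1
        funext i
        rw [Scheme.Modules.Hom.app_smul, locFun_smul]; rfl })
    (fun U W h m ↦ by
      change combination N s _ (fun i ↦ locFun V W ((ε i).app W (rm P h m))) =
        rm N _ (combination N s _ (fun i ↦ locFun V U ((ε i).app U m)))
      rw [rm_combination]
      congr 1
      funext i
      rw [app_rm, locFun_rm])

/-- The universal property only produces morphisms out of the whole of `f^* M`, whereas coordinates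
exist only over `U`. They are therefore taken with values in `localize V 𝒪`, the extension `j_* j^*
𝒪` for the inclusion `j` of `V = f⁻¹ U`. The identities saying that coordinates and basis are
mutually inverse then need checking on pulled-back sections only. -/
lemma IsBasisOn.pullback (f : X ⟶ Y) {M : Y.Modules} {ι : Type*} [Fintype ι] {U : Y.Opens}
    {e : ι → Γ(M, U)} (he : IsBasisOn M e) :
    IsBasisOn ((Scheme.Modules.pullback f).obj M) (fun i ↦ pb f M U (e i)) := by
  classical
  let P := (Scheme.Modules.pullback f).obj M
  let V := f ⁻¹ᵁ U
  let c (W : Y.Opens) : Γ(Y, W ⊓ U) →+* Γ(X, f ⁻¹ᵁ W ⊓ V) := (f.app (W ⊓ U)).hom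
  have hε (i : ι) : ∃ ε : P ⟶ localize V (structureSheaf X), ∀ W m,
      ε.app (f ⁻¹ᵁ W) (pb f M W m) = (locFun V (f ⁻¹ᵁ W)).symm
        (c W (he.coeff inf_le_right (rm M inf_le_left m) i)) := by
    refine exists_pullback_hom f (N := localize V (structureSheaf X)) (fun W ↦
      { toFun := fun m ↦ (locFun V (f ⁻¹ᵁ W)).symm
          (c W (he.coeff inf_le_right (rm M inf_le_left m) i))
        map_add' := fun m m' ↦ by simp only [map_add, Pi.add_apply (M := fun _ ↦ Γ(Y, W ⊓ U))]
        map_smul' := fun a m ↦ ?_ }) ?_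
    · apply (locFun V _).injective
      rw [locFun_smul, AddEquiv.apply_symm_apply, AddEquiv.apply_symm_apply, map_smulₛₗ, map_smul,
        Pi.smul_apply, smul_eq_mul, map_mul]
      exact congrArg (· * _) (rs_app f inf_le_left a).symm
    · intro W W' h m
      change c W' _ = rs _ (c W _)
      refine Eq.trans ?_ (rs_app f (inf_le_inf_right U h) _).symm
      rw [rm_rm]
      refine congrArg _ ?_
      have := congrFun (he.coeff_rm inf_le_right (inf_le_inf_right U h) (rm M inf_le_left m)) i
      rw [rm_rm] at this
      exact this
  choose ε hε using hε
  -- This is "every section is the combination of the basis with its coordinates", stated as an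
  -- equality of morphisms `P ⟶ j_* j^* P` so that `pullback_hom_ext` applies.
  have hσρ : toLocalize V P = localCombination ε (fun i ↦ pb f M U (e i)) := by
    refine pullback_hom_ext f fun W m ↦ ?_
    apply (locSec V P _).injective
    change rm P _ (pb f M W m) = combination P _ _ (fun i ↦ locFun V _ ((ε i).app _ (pb f M W m)))
    simp only [hε, AddEquiv.apply_symm_apply]
    refine (pb_rm f M (inf_le_left : W ⊓ U ≤ W) m).symm.trans ?_
    conv_lhs => rw [← he.combination_coeff inf_le_right (rm M inf_le_left m)]
    rw [combination_apply, map_sum]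
    refine Finset.sum_congr rfl fun i _ ↦ ?_
    rw [map_smulₛₗ, pb_rm]
    rfl
  have hεe (i j) : (ε i).app V (pb f M U (e j)) = (locFun V V).symm
      (if i = j then 1 else 0) := by
    refine (hε i U (e j)).trans (congrArg _ ?_)
    rw [he.coeff_basis]
    rcases eq_or_ne i j with rfl | h
    · rw [Pi.single_eq_same, if_pos rfl]; exact map_one _
    · rw [Pi.single_eq_of_ne h, if_neg h]; exact map_zero _
  refine isBasisOn_of_coeff (fun W h x i ↦ rs (le_inf le_rfl h) (locFun V W ((ε i).app W x)))
    (fun W h a ↦ ?_) (fun W h x ↦ ?_)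
  · funext i
    rw [combination_apply, map_sum, map_sum, map_sum, Finset.sum_eq_single i]
    · rw [Scheme.Modules.Hom.app_smul, locFun_smul, map_mul, rs_rs, rs_self, app_rm, hεe, locFun_rm,
        AddEquiv.apply_symm_apply, if_pos rfl, map_one, map_one, mul_one]
    · intro j _ hj
      rw [Scheme.Modules.Hom.app_smul, locFun_smul, map_mul, app_rm, hεe, locFun_rm,
        AddEquiv.apply_symm_apply, if_neg hj.symm, map_zero, map_zero, mul_zero]
    · simp
  · have h1 := congrArg (fun k ↦ rm P (le_inf le_rfl h) (locSec V P W (Scheme.Modules.Hom.app k W x)))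
      hσρ
    refine Eq.trans ?_ (h1.symm.trans ?_)
    · exact (rm_combination P _ inf_le_right (le_inf le_rfl h) _).symm
    · exact (rm_rm P inf_le_left (le_inf le_rfl h) x).trans (rm_self P x)

lemma IsLocallyFree.pullback (f : X ⟶ Y) {M : Y.Modules} (hM : IsLocallyFree M) :
    IsLocallyFree ((Scheme.Modules.pullback f).obj M) :=
  fun x ↦ let ⟨U, hx, n, _, he⟩ := hM (f x); ⟨f ⁻¹ᵁ U, hx, n, _, he.pullback f⟩

/-! ### Sections of associated sheaves -/

section Sheafify

variable (P : X.PresheafOfModules)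

instance (W : X.Opens) : Module Γ(X, W) (P.obj (op W)) := (P.obj (op W)).isModule

/-- Restriction of sections of a presheaf of modules. -/
def rp {U V : X.Opens} (h : V ≤ U) : P.obj (op U) →ₛₗ[rs h] P.obj (op V) where
  toFun x := P.map (homOfLE h).op x
  map_add' := map_add (P.map (homOfLE h).op).hom
  map_smul' := PresheafOfModules.map_smul P (homOfLE h).op

/-- The section of the associated sheaf defined by a section of a presheaf. -/
def toSheafify (W : X.Opens) : P.obj (op W) →ₗ[Γ(X, W)] Γ(sheafify P, W) where
  toFun x := ((PresheafOfModules.sheafificationAdjunction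
    (𝟙 X.ringCatSheaf.obj)).unit.app P).app (op W) x
  map_add' := map_add (((PresheafOfModules.sheafificationAdjunction
    (𝟙 X.ringCatSheaf.obj)).unit.app P).app (op W)).hom
  map_smul' := (((PresheafOfModules.sheafificationAdjunction
    (𝟙 X.ringCatSheaf.obj)).unit.app P).app (op W)).hom.map_smul

lemma toSheafify_rp {U V : X.Opens} (h : V ≤ U) (x : P.obj (op U)) :
    toSheafify P V (rp P h x) = rm (sheafify P) h (toSheafify P U x) :=
  PresheafOfModules.naturality_apply ((PresheafOfModules.sheafificationAdjunction
    (𝟙 X.ringCatSheaf.obj)).unit.app P) (homOfLE h).op x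

lemma exists_sheafify_hom {N : X.Modules} (g : ∀ W, P.obj (op W) →ₗ[Γ(X, W)] Γ(N, W))
    (hg : ∀ (U V : X.Opens) (h : V ≤ U) (x : P.obj (op U)), g V (rp P h x) = rm N h (g U x)) :
    ∃ a : sheafify P ⟶ N, ∀ W x, a.app W (toSheafify P W x) = g W x := by
  let γ : P ⟶ (SheafOfModules.forget X.ringCatSheaf ⋙
      PresheafOfModules.restrictScalars (𝟙 X.ringCatSheaf.obj)).obj N :=
    { app := fun W ↦ ModuleCat.ofHom
        (Y := (PresheafOfModules.restrictScalars (𝟙 X.ringCatSheaf.obj) |>.obj N.val).obj W)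
        { toFun := g W.unop
          map_add' := map_add _
          map_smul' := (g W.unop).map_smul }
      naturality := fun f ↦ by
        ext x
        exact hg _ _ f.unop.le x }
  let adj := PresheafOfModules.sheafificationAdjunction (𝟙 X.ringCatSheaf.obj)
  refine ⟨(adj.homEquiv _ _).symm γ, fun W x ↦ ?_⟩
  have := (adj.homEquiv P N).apply_symm_apply γ
  replace this := (adj.homEquiv_unit P N _).symm.trans this
  exact congrArg (fun k ↦ (PresheafOfModules.Hom.app k (op W)) x) this

end Sheafify

/-! ### Tensor products -/

section Tensor

variable (M N : X.Modules)

/-- The presheaf `U ↦ M(U) ⊗ N(U)`. -/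
def tensorPresheaf : X.PresheafOfModules :=
  PresheafOfModules.Monoidal.tensorObj (R := X.presheaf) M.val N.val

/-- The sections of the presheaf `U ↦ M(U) ⊗ N(U)`. -/
def tensorPresheafEquiv (W : X.Opens) :
    TensorProduct Γ(X, W) Γ(M, W) Γ(N, W) ≃ₗ[Γ(X, W)] (tensorPresheaf M N).obj (op W) where
  toFun x := x
  invFun x := x
  map_add' _ _ := rfl
  map_smul' _ _ := rfl
  left_inv _ := rfl
  right_inv _ := rfl

/-- The section `m ⊗ n` of the tensor product. -/
def tm (W : X.Opens) : Γ(M, W) →ₗ[Γ(X, W)] Γ(N, W) →ₗ[Γ(X, W)] Γ(tensor M N, W) :=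
  (TensorProduct.mk Γ(X, W) Γ(M, W) Γ(N, W)).compr₂
    (toSheafify (tensorPresheaf M N) W ∘ₗ (tensorPresheafEquiv M N W).toLinearMap)

lemma rm_tm {U V : X.Opens} (h : V ≤ U) (m : Γ(M, U)) (n : Γ(N, U)) :
    rm _ h (tm M N U m n) = tm M N V (rm M h m) (rm N h n) :=
  (toSheafify_rp (tensorPresheaf M N) h (tensorPresheafEquiv M N U (m ⊗ₜ n))).symm

variable {M N}

lemma exists_tensor_hom {K : X.Modules}
    (g : ∀ W, Γ(M, W) →ₗ[Γ(X, W)] Γ(N, W) →ₗ[Γ(X, W)] Γ(K, W))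
    (hg : ∀ (U V : X.Opens) (h : V ≤ U) (m : Γ(M, U)) (n : Γ(N, U)),
      g V (rm M h m) (rm N h n) = rm K h (g U m n)) :
    ∃ a : tensor M N ⟶ K, ∀ W m n, a.app W (tm M N W m n) = g W m n := by
  obtain ⟨a, ha⟩ := exists_sheafify_hom (tensorPresheaf M N) (N := K)
    (fun W ↦ TensorProduct.lift (g W) ∘ₗ (tensorPresheafEquiv M N W).symm.toLinearMap)
    (fun U V h x ↦ by
      obtain ⟨x, rfl⟩ := (tensorPresheafEquiv M N U).surjective x
      induction x using TensorProduct.induction_on with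
      | zero => simp only [map_zero]
      | add x y hx hy => rw [map_add, map_add, map_add, map_add, map_add, hx, hy]
      | tmul m n => exact hg U V h m n)
  exact ⟨a, fun W m n ↦ ha W (tensorPresheafEquiv M N W (m ⊗ₜ n))⟩

/-- Tensor products of isomorphic presheaves of modules are isomorphic. -/
def tensorObjIso {C : Type*} [Category C] {R : Cᵒᵖ ⥤ CommRingCat.{u}}
    {M M' : PresheafOfModules.{u} (R ⋙ forget₂ CommRingCat RingCat)} (e : M ≅ M')
    (N : PresheafOfModules.{u} (R ⋙ forget₂ CommRingCat RingCat)) :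
    PresheafOfModules.Monoidal.tensorObj M N ≅ PresheafOfModules.Monoidal.tensorObj M' N :=
  MonoidalCategory.whiskerRightIso e N

/-- Tensor products of isomorphic sheaves are isomorphic. -/
def tensorIso {M M' : X.Modules} (e : M ≅ M') (N : X.Modules) : tensor M N ≅ tensor M' N :=
  (PresheafOfModules.sheafification (𝟙 X.ringCatSheaf.obj)).mapIso
    (tensorObjIso (R := X.presheaf) ((SheafOfModules.forget X.ringCatSheaf).mapIso e) N.val)

end Tensor

/-! ### Differentials -/

section Differentials

variable (f : X ⟶ Y)

/-- The morphism `f⁻¹ 𝒪_Y ⟶ 𝒪_X` of presheaves. -/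
abbrev inverseImageRing : (TopCat.Presheaf.pullback CommRingCat.{u} f.base).obj Y.presheaf ⟶ X.presheaf :=
  ((TopCat.Presheaf.pullbackPushforwardAdjunction CommRingCat.{u} f.base).homEquiv _ _).symm f.c

/-- The presheaf whose associated sheaf is `Ω_f`. -/
def diffPresheaf : X.PresheafOfModules :=
  PresheafOfModules.DifferentialsConstruction.relativeDifferentials' (inverseImageRing f)

/-- The universal derivation at the level of presheaves. -/
def preDeriv : PresheafOfModules.Derivation' (R := X.presheaf) (diffPresheaf f)
    (inverseImageRing f) :=
  PresheafOfModules.DifferentialsConstruction.derivation' (inverseImageRing f)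

/-- The universal derivation `𝒪_X → Ω_f`. -/
def dd (W : X.Opens) : Γ(X, W) →+ Γ(relativeDifferentials f, W) :=
  (toSheafify (diffPresheaf f) W).toAddMonoidHom.comp ((preDeriv f).d (X := op W))

lemma dd_mul (W : X.Opens) (a b : Γ(X, W)) :
    dd f W (a * b) = a • dd f W b + b • dd f W a := by
  refine (congrArg (toSheafify (diffPresheaf f) W) ((preDeriv f).d_mul (X := op W) a b)).trans ?_
  refine (map_add (toSheafify (diffPresheaf f) W) _ _).trans (congrArg₂ _ ?_ ?_)
  all_goals exact (toSheafify (diffPresheaf f) W).map_smul _ _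

lemma dd_one (W : X.Opens) : dd f W 1 = 0 := by
  simpa using dd_mul f W 1 1

lemma rm_dd {U V : X.Opens} (h : V ≤ U) (a : Γ(X, U)) :
    rm _ h (dd f U a) = dd f V (rs h a) :=
  (toSheafify_rp (diffPresheaf f) h _).symm.trans
    (congrArg (toSheafify (diffPresheaf f) V) ((preDeriv f).d_map (homOfLE h).op a).symm)

lemma dd_app (U : Y.Opens) (b : Γ(Y, U)) : dd f (f ⁻¹ᵁ U) (f.app U b) = 0 := by
  let adj := TopCat.Presheaf.pullbackPushforwardAdjunction CommRingCat.{u} f.base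
  have h : adj.unit.app Y.presheaf ≫ _ = f.c :=
    (adj.homEquiv_unit Y.presheaf X.presheaf (inverseImageRing f)).symm.trans
      ((adj.homEquiv _ _).apply_symm_apply f.c)
  have h' : (inverseImageRing f).app (op (f ⁻¹ᵁ U)) ((adj.unit.app Y.presheaf).app (op U) b) =
      f.app U b :=
    congrArg (fun k : Y.presheaf ⟶ (TopCat.Presheaf.pushforward CommRingCat f.base).obj X.presheaf ↦
      (k.app (op U)).hom b) h
  rw [← h']
  exact (congrArg (toSheafify (diffPresheaf f) (f ⁻¹ᵁ U))
    ((preDeriv f).d_app (X := op (f ⁻¹ᵁ U)) _)).trans (map_zero _)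

variable {N : X.Modules} (δ : ∀ W : X.Opens, Γ(X, W) →+ Γ(N, W))
    (h_mul : ∀ W a b, δ W (a * b) = a • δ W b + b • δ W a)
    (h_rs : ∀ (U V : X.Opens) (h : V ≤ U) a, δ V (rs h a) = rm N h (δ U a))

/-- The functions killed by a derivation. -/
def constantsSubring (W : X.Opens) : Subring Γ(X, W) where
  carrier := {a | δ W a = 0}
  mul_mem' := by
    intro a b (ha : δ W a = 0) (hb : δ W b = 0)
    change δ W (a * b) = 0
    rw [h_mul, ha, hb, smul_zero, smul_zero, add_zero]
  one_mem' := by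
    change δ W 1 = 0
    simpa using h_mul W 1 1
  add_mem' := by
    intro a b (ha : δ W a = 0) (hb : δ W b = 0)
    change δ W (a + b) = 0
    rw [map_add, ha, hb, add_zero]
  zero_mem' := map_zero _
  neg_mem' := by
    intro a (ha : δ W a = 0)
    change δ W (-a) = 0
    rw [map_neg, ha, neg_zero]

/-- The presheaf of functions killed by a derivation. -/
def constants : TopCat.Presheaf CommRingCat.{u} X where
  obj W := .of (constantsSubring δ h_mul W.unop)
  map {_ V} g := CommRingCat.ofHom (((rs g.unop.le).comp (Subring.subtype _)).codRestrict
    (constantsSubring δ h_mul V.unop)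
    fun a ↦ (h_rs _ _ g.unop.le a.1).trans ((congrArg _ a.2).trans (map_zero _)))
  map_id _ := CommRingCat.hom_ext (RingHom.ext fun a ↦ Subtype.ext (rs_self a.1))
  map_comp g g' := CommRingCat.hom_ext (RingHom.ext fun a ↦
    Subtype.ext (rs_rs g.unop.le g'.unop.le a.1).symm)

include h_mul h_rs in
-- The functions killed by `δ` form a presheaf of subrings through which `f.c` factors by `h_app`.
-- By adjunction the map `f⁻¹ 𝒪_Y ⟶ 𝒪_X` factors through it too, so the presheaf inverse image need
-- not be described as a colimit.
lemma derivation_inverseImageRing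
    (h_app : ∀ (U : Y.Opens) (b : Γ(Y, U)), δ (f ⁻¹ᵁ U) (f.app U b) = 0) (W : X.Opens)
    (a : ((TopCat.Presheaf.pullback CommRingCat.{u} f.base).obj Y.presheaf).obj (op W)) :
    δ W ((inverseImageRing f).app (op W) a) = 0 := by
  let K := constants δ h_mul h_rs
  let i : K ⟶ X.presheaf :=
    { app := fun W ↦ CommRingCat.ofHom (constantsSubring δ h_mul W.unop).subtype
      naturality := fun _ _ _ ↦ rfl }
  let c : Y.presheaf ⟶ (TopCat.Presheaf.pushforward CommRingCat f.base).obj K :=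
    { app := fun U ↦ CommRingCat.ofHom ((f.app U.unop).hom.codRestrict
        (constantsSubring δ h_mul (f ⁻¹ᵁ U.unop)) (h_app U.unop))
      naturality := fun U V g ↦ by
        ext b
        exact Subtype.ext (ConcreteCategory.congr_hom (f.c.naturality g) b) }
  have hc : c ≫ (TopCat.Presheaf.pushforward CommRingCat f.base).map i = f.c := rfl
  have h := (TopCat.Presheaf.pullbackPushforwardAdjunction CommRingCat.{u}
    f.base).homEquiv_naturality_right_symm c i
  rw [hc] at h
  refine (congrArg (fun k : (TopCat.Presheaf.pullback CommRingCat.{u} f.base).obj Y.presheaf ⟶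
    X.presheaf ↦ δ W ((k.app (op W)).hom a)) h).trans ?_
  exact Subtype.property (p := (· ∈ constantsSubring δ h_mul W)) _

include h_mul h_rs in
lemma exists_differentials_hom
    (h_app : ∀ (U : Y.Opens) (b : Γ(Y, U)), δ (f ⁻¹ᵁ U) (f.app U b) = 0) :
    ∃ a : relativeDifferentials f ⟶ N, ∀ W b, a.app W (dd f W b) = δ W b := by
  let d : PresheafOfModules.Derivation' (R := X.presheaf) N.val (inverseImageRing f) :=
    { d := fun {W} ↦ δ W.unop
      d_mul := fun {W} ↦ h_mul W.unop
      d_map := fun {_ _} g a ↦ h_rs _ _ g.unop.le a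
      d_app := fun {W} a ↦ derivation_inverseImageRing f δ h_mul h_rs h_app W.unop a }
  let univ := PresheafOfModules.DifferentialsConstruction.isUniversal' (inverseImageRing f)
  obtain ⟨a, ha⟩ := exists_sheafify_hom (diffPresheaf f)
    (N := N) (fun W ↦ ((univ.desc d).app (op W)).hom)
    (fun U V h x ↦ PresheafOfModules.naturality_apply (univ.desc d) (homOfLE h).op x)
  refine ⟨a, fun W b ↦ (ha W _).trans ?_⟩
  exact PresheafOfModules.Derivation.congr_d (univ.fac d) (X := op W) b

end Differentials

/-! ### The canonical connection on a pull-back -/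

section Connection

variable (f : X ⟶ Y) (P : X.Modules)

/-- The data of the sheaf `P ⊕ (P ⊗ Ω_f)`, on which a function `a` acts by
`(x, y) ↦ (a x, a y + x ⊗ da)`. -/
def jetData : ModuleData X where
  sec W := Γ(P, W) × Γ(tensor P (relativeDifferentials f), W)
  module W :=
    { smul := fun a x ↦ (a • x.1, a • x.2 + tm P _ W x.1 (dd f W a))
      one_smul := fun x ↦ Prod.ext (one_smul _ _) (by
        change (1 : Γ(X, W)) • x.2 + tm P _ W x.1 (dd f W 1) = x.2
        rw [dd_one, map_zero, one_smul, add_zero])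
      mul_smul := fun a b x ↦ Prod.ext (mul_smul _ _ _) (by
        change (a * b) • x.2 + tm P _ W x.1 (dd f W (a * b)) =
          a • (b • x.2 + tm P _ W x.1 (dd f W b)) + tm P _ W (b • x.1) (dd f W a)
        rw [dd_mul, map_add, map_smul, map_smul, map_smul, LinearMap.smul_apply, smul_add, mul_smul,
          add_assoc])
      smul_zero := fun a ↦ Prod.ext (smul_zero _) (by
        change a • (0 : Γ(tensor P (relativeDifferentials f), W)) + tm P _ W 0 (dd f W a) = 0
        rw [smul_zero, map_zero, LinearMap.zero_apply, add_zero])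
      smul_add := fun a x y ↦ Prod.ext (smul_add _ _ _) (by
        change a • (x.2 + y.2) + tm P _ W (x.1 + y.1) (dd f W a) =
          (a • x.2 + tm P _ W x.1 (dd f W a)) + (a • y.2 + tm P _ W y.1 (dd f W a))
        rw [smul_add, map_add, LinearMap.add_apply, add_add_add_comm])
      add_smul := fun a b x ↦ Prod.ext (add_smul _ _ _) (by
        change (a + b) • x.2 + tm P _ W x.1 (dd f W (a + b)) =
          (a • x.2 + tm P _ W x.1 (dd f W a)) + (b • x.2 + tm P _ W x.1 (dd f W b))
        rw [add_smul, map_add, map_add, add_add_add_comm])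
      zero_smul := fun x ↦ Prod.ext (zero_smul _ _) (by
        change (0 : Γ(X, W)) • x.2 + tm P _ W x.1 (dd f W 0) = 0
        rw [zero_smul, map_zero, map_zero, add_zero]) }
  res h := (rm P h).toAddMonoidHom.prodMap (rm (tensor P (relativeDifferentials f)) h).toAddMonoidHom
  res_self s := Prod.ext (rm_self P s.1) (rm_self _ s.2)
  res_res h h' s := Prod.ext (rm_rm P h h' s.1) (rm_rm _ h h' s.2)
  res_smul {U V} h a s := Prod.ext ((rm P h).map_smulₛₗ a s.1) (by
    change rm _ h (a • s.2 + tm P _ U s.1 (dd f U a)) =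
      rs h a • rm _ h s.2 + tm P _ V (rm P h s.1) (dd f V (rs h a))
    rw [map_add, map_smulₛₗ, rm_tm, rm_dd])
  existsUnique_glue U s hs := by
    obtain ⟨t₁, h₁, h₁'⟩ := existsUnique_glue P U (iSup U) (le_iSup U) le_rfl (fun i ↦ (s i).1)
      (fun i j ↦ congrArg Prod.fst (hs i j))
    obtain ⟨t₂, h₂, h₂'⟩ := existsUnique_glue (tensor P (relativeDifferentials f)) U (iSup U)
      (le_iSup U) le_rfl (fun i ↦ (s i).2) (fun i j ↦ congrArg Prod.snd (hs i j))
    exact ⟨(t₁, t₂), fun i ↦ Prod.ext (h₁ i) (h₂ i), fun t ht ↦ Prod.ext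
      (h₁' _ fun i ↦ congrArg Prod.fst (ht i)) (h₂' _ fun i ↦ congrArg Prod.snd (ht i))⟩

variable (M : Y.Modules)

/-- The canonical connection on `f^* M`. -/
lemma exists_connection :
    ∃ D : ∀ W, Γ((Scheme.Modules.pullback f).obj M, W) →+
        Γ(tensor ((Scheme.Modules.pullback f).obj M) (relativeDifferentials f), W),
      (∀ (U V : X.Opens) (h : V ≤ U) x, D V (rm _ h x) = rm _ h (D U x)) ∧
      (∀ W a x, D W (a • x) = a • D W x + tm _ _ W x (dd f W a)) ∧
      (∀ U m, D (f ⁻¹ᵁ U) (pb f M U m) = 0) := by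
  let P := (Scheme.Modules.pullback f).obj M
  let J := jetData f P
  -- The assignment `m ↦ (f^* m, 0)` is linear over `𝒪_Y` for the twisted action on the jet module
  -- because `d` kills functions coming from `Y`; it therefore extends to an `𝒪_X`-linear `σ`.
  obtain ⟨σ, hσ⟩ := exists_pullback_hom f (M := M) (N := J.toModules)
    (fun W ↦
      { toFun := fun m ↦ ((pb f M W m, 0) : J.sec (f ⁻¹ᵁ W))
        map_add' := fun m m' ↦ Prod.ext (map_add _ _ _) (add_zero _).symm
        map_smul' := fun a m ↦ Prod.ext (map_smulₛₗ _ _ _) (by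
          change 0 = f.app W a • (0 : Γ(tensor P (relativeDifferentials f), f ⁻¹ᵁ W)) +
            tm P _ _ (pb f M W m) (dd f _ (f.app W a))
          rw [dd_app, map_zero, smul_zero, add_zero]) })
    (fun W W' h m ↦ Prod.ext (pb_rm f M h m) (map_zero (rm _ _)).symm)
  let ρ : J.toModules ⟶ P := homMk (fun W ↦
    { toFun := fun x ↦ (show J.sec W from x).1
      map_add' := fun _ _ ↦ rfl
      map_smul' := fun _ _ ↦ rfl }) (fun _ _ _ _ ↦ rfl)
  have hρ : σ ≫ ρ = 𝟙 P := pullback_hom_ext f fun W m ↦ by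
    change (show J.sec _ from σ.app (f ⁻¹ᵁ W) (pb f M W m)).1 = pb f M W m
    rw [hσ]; rfl
  have hρ' (W) (x : Γ(P, W)) : (show J.sec W from σ.app W x).1 = x :=
    congrArg (fun k : P ⟶ P ↦ k.app W x) hρ
  -- The first component of `σ` is the identity, so its linearity for the twisted action says
  -- exactly that the second component satisfies the Leibniz rule.
  refine ⟨fun W ↦ (AddMonoidHom.snd _ _).comp (show Γ(P, W) →+ J.sec W from (σ.app W).hom),
    fun U V h x ↦ ?_, fun W a x ↦ ?_, fun U m ↦ ?_⟩
  · exact congrArg Prod.snd (app_rm σ h x)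
  · refine (congrArg Prod.snd (Scheme.Modules.Hom.app_smul σ a x)).trans ?_
    change a • (show J.sec W from σ.app W x).2 + tm P _ W (show J.sec W from σ.app W x).1 _ = _
    rw [hρ']; rfl
  · exact congrArg Prod.snd (hσ U m)

end Connection

/-! ### Derivations detect `p`-th powers -/

-- Take a subfield `L` maximal among those containing `K^p` and avoiding `a`. Every element outside
-- `L` has degree `p` over `L`, and maximality forces `K = L(a)`. If `da` were zero in `Ω[K⁄L]`,
-- then `K` would be unramified as well as purely inseparable over `L`, so `K = L`, contradicting `a
-- ∉ L`. A linear form not vanishing at `da` gives the derivation.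
open IntermediateField in
lemma exists_derivation_ne_zero {K : Type*} [Field K] (p : ℕ) [hp : Fact p.Prime] [CharP K p] {a : K}
    (ha : ∀ b : K, b ^ p ≠ a) : ∃ D : Derivation ℤ K K, D a ≠ 0 := by
  have hfin {L : Subfield K} {c : K} (hL : c ^ p ∈ L) (hc : c ∉ L) :
      Module.finrank L L⟮c⟯ = p := by
    have hirr : Irreducible (Polynomial.X ^ p - Polynomial.C (⟨c ^ p, hL⟩ : L)) := by
      refine X_pow_sub_C_irreducible_of_prime hp.out fun b hb ↦ hc ?_
      have : (b : K) ^ p = c ^ p := congrArg Subtype.val hb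
      rw [← frobenius_inj K p this]
      exact b.2
    have hmon : (Polynomial.X ^ p - Polynomial.C (⟨c ^ p, hL⟩ : L)).Monic :=
      Polynomial.monic_X_pow_sub_C _ hp.out.ne_zero
    have hev : Polynomial.aeval c (Polynomial.X ^ p - Polynomial.C (⟨c ^ p, hL⟩ : L)) = 0 := by
      simp only [map_sub, map_pow, Polynomial.aeval_X, Polynomial.aeval_C]
      exact sub_self _
    rw [adjoin.finrank ⟨_, hmon, hev⟩, ← minpoly.eq_of_irreducible_of_monic hirr hev hmon,
      Polynomial.natDegree_X_pow_sub_C]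
  let S : Set (Subfield K) := {L | (∀ c : K, c ^ p ∈ L) ∧ a ∉ L}
  obtain ⟨L, hL⟩ : ∃ L, Maximal (· ∈ S) L := by
    refine zorn_le₀ S fun c hcS hc ↦ ?_
    rcases c.eq_empty_or_nonempty with rfl | hne
    -- For the empty chain the upper bound is `K^p` itself; it avoids `a` precisely because `a` is
    -- not a `p`-th power.
    · refine ⟨(frobenius K p).fieldRange, ⟨fun c ↦ ⟨c, rfl⟩, ?_⟩, by simp⟩
      rintro ⟨b, hb⟩
      exact ha b hb
    · refine ⟨sSup c, ⟨fun x ↦ ?_, fun h ↦ ?_⟩, fun L hL ↦ le_sSup hL⟩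
      · obtain ⟨L, hL⟩ := hne
        exact le_sSup hL ((hcS hL).1 x)
      · obtain ⟨L, hL, hL'⟩ := (Subfield.mem_sSup_of_directedOn hne hc.directedOn).1 h
        exact (hcS hL).2 hL'
  have hLp := hL.1.1
  have hLa := hL.1.2
  have htop : L⟮a⟯ = ⊤ := by
    rw [eq_top_iff]
    intro b _
    by_cases hb : b ∈ L
    · exact L⟮a⟯.algebraMap_mem ⟨b, hb⟩
    have hab : a ∈ L⟮b⟯ := by
      by_contra h
      have hle : L ≤ L⟮b⟯.toSubfield := fun x hx ↦ L⟮b⟯.algebraMap_mem ⟨x, hx⟩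
      have := hL.2 (y := L⟮b⟯.toSubfield) ⟨fun c ↦ hle (hLp c), h⟩ hle
      exact hb (this (mem_adjoin_simple_self L b))
    have : FiniteDimensional L L⟮b⟯ :=
      Module.finite_of_finrank_pos (by rw [hfin (hLp b) hb]; exact hp.out.pos)
    -- Both fields have degree `p` over `L` and one contains the other, so an arbitrary `b` outside
    -- `L` lies in `L(a)`.
    have heq : L⟮a⟯ = L⟮b⟯ := eq_of_le_of_finrank_eq (adjoin_simple_le_iff.2 hab)
      (by rw [hfin (hLp a) hLa, hfin (hLp b) hb])
    rw [heq]
    exact mem_adjoin_simple_self L b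
  have hD : KaehlerDifferential.D L K a ≠ 0 := by
    intro h0
    have hall (x : K) : KaehlerDifferential.D L K x = 0 := by
      have hx : x ∈ L⟮a⟯ := htop ▸ mem_top
      induction hx using adjoin_induction with
      | mem x hx => rw [Set.mem_singleton_iff.1 hx, h0]
      | algebraMap x => exact Derivation.map_algebraMap _ x
      | add x y _ _ hx hy => rw [map_add, hx, hy, add_zero]
      | inv x _ hx => rw [Derivation.leibniz_inv, hx, smul_zero]
      | mul x y _ _ hx hy => rw [Derivation.leibniz, hx, hy, smul_zero, smul_zero, add_zero]
    have : Subsingleton (Ω[K⁄L]) := by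
      refine (Submodule.subsingleton_iff K).1 (subsingleton_of_bot_eq_top ?_)
      rw [← KaehlerDifferential.span_range_derivation, eq_comm, Submodule.span_eq_bot]
      rintro _ ⟨x, rfl⟩
      exact hall x
    have : Algebra.FormallyUnramified L K := ⟨this⟩
    have : CharP L p :=
      ((algebraMap L K).charP_iff (algebraMap L K).injective p).2 inferInstance
    have : ExpChar L p := .prime hp.out
    have : IsPurelyInseparable L K := by
      rw [isPurelyInseparable_iff_pow_mem L p]
      exact fun x ↦ ⟨1, ⟨x ^ p, hLp x⟩, by rw [pow_one]; rfl⟩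
    have : FiniteDimensional L L⟮a⟯ :=
      Module.finite_of_finrank_pos (by rw [hfin (hLp a) hLa]; exact hp.out.pos)
    have : FiniteDimensional L K := by
      rw [htop] at this
      exact Module.Finite.equiv (topEquiv (F := L) (E := K)).toLinearEquiv
    have h : a ∈ (algebraMap L K).range := by
      rw [Algebra.FormallyUnramified.range_eq_top_of_isPurelyInseparable L K]
      exact Subring.mem_top a
    obtain ⟨b, hb⟩ := h
    exact hLa (hb ▸ b.2)
  obtain ⟨φ, hφ⟩ : ∃ φ : Module.Dual K (Ω[K⁄L]), φ (KaehlerDifferential.D L K a) ≠ 0 := by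
    by_contra! h
    exact hD ((Module.forall_dual_apply_eq_zero_iff K _).1 h)
  exact ⟨(φ.compDer (KaehlerDifferential.D L K)).restrictScalars ℤ, hφ⟩

/-! ### Rational functions on normal schemes -/

section FunctionField

variable [IrreducibleSpace X]

/-- The germ at the generic point. -/
def gg {W : X.Opens} (h : genericPoint X ∈ W) : Γ(X, W) →+* X.functionField :=
  (X.presheaf.germ W (genericPoint X) h).hom

lemma gg_rs {U V : X.Opens} (hVU : V ≤ U) (h : genericPoint X ∈ V) (a : Γ(X, U)) :
    gg h (rs hVU a) = gg (hVU h) a :=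
  X.presheaf.germ_res_apply (homOfLE hVU) _ h a

lemma genericPoint_mem {W : X.Opens} {x : X} (hx : x ∈ W) : genericPoint X ∈ W :=
  ((genericPoint_spec X).mem_open_set_iff W.isOpen).mpr ⟨x, trivial, hx⟩

end FunctionField

lemma gg_injective [IsIntegral X] {W : X.Opens} (h : genericPoint X ∈ W) :
    Function.Injective (gg h) :=
  germ_injective_of_isIntegral X (genericPoint X) h

lemma existsUnique_glue_fun {ι : Type u} (U : ι → X.Opens) (V : X.Opens)
    (hU : ∀ i, U i ≤ V) (hV : V ≤ iSup U) (s : ∀ i, Γ(X, U i))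
    (hs : ∀ i j, rs (inf_le_left : U i ⊓ U j ≤ U i) (s i) = rs inf_le_right (s j)) :
    ∃! t : Γ(X, V), ∀ i, rs (hU i) t = s i :=
  TopCat.Sheaf.existsUnique_gluing' X.sheaf U V (fun i ↦ homOfLE (hU i)) hV s hs

/-- On a normal integral scheme, rational functions which are integral over all local rings of an
open subset are regular there. -/
lemma exists_gg_eq [IsIntegral X] (hX : IsNormalScheme X) {W : X.Opens} (h : genericPoint X ∈ W)
    (k : X.functionField) (hk : ∀ x ∈ W, _root_.IsIntegral (X.presheaf.stalk x) k) :
    ∃ a : Γ(X, W), gg h a = k := by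
  have hloc (x : W) : ∃ (U : X.Opens) (_ : U ≤ W) (hx : x.1 ∈ U) (a : Γ(X, U)),
      gg (genericPoint_mem hx) a = k := by
    have := (hX x.1).2
    obtain ⟨y, hy⟩ := IsIntegrallyClosed.isIntegral_iff.1 (hk x.1 x.2)
    obtain ⟨U, hx, a, rfl⟩ := X.presheaf.exists_germ_eq y
    refine ⟨U ⊓ W, inf_le_right, ⟨hx, x.2⟩, rs inf_le_left a, ?_⟩
    rw [gg_rs]
    have : Nonempty U := ⟨x.1, hx⟩
    rw [← hy, Scheme.algebraMap_germ_eq_germToFunctionField]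
    rfl
  choose U hUW hxU a ha using hloc
  obtain ⟨t, ht, -⟩ := existsUnique_glue_fun U W hUW
    (fun x hx ↦ Opens.mem_iSup.2 ⟨⟨x, hx⟩, hxU ⟨x, hx⟩⟩) a (fun x y ↦ by
      have hη : genericPoint X ∈ U x ⊓ U y :=
        ⟨genericPoint_mem (hxU x), genericPoint_mem (hxU y)⟩
      apply gg_injective hη
      rw [gg_rs, gg_rs, ha, ha])
  let x : W := ⟨_, h⟩
  refine ⟨t, ?_⟩
  rw [← ha x, ← ht x, gg_rs]

/-! ### The constant sheaf of rational functions -/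

section Sky

variable (X) [IrreducibleSpace X]

/-- The data of the constant sheaf of rational functions. -/
def ratData : ModuleData X where
  -- A function on the proposition that `W` contains the generic point: this gives the function
  -- field for nonempty `W` and the zero module for empty `W`, as the sheaf condition demands.
  sec W := PLift (genericPoint X ∈ W) → X.functionField
  module W :=
    { smul := fun a s h ↦ gg h.down a * s h
      one_smul := fun s ↦ funext fun h ↦ by
        change gg h.down 1 * s h = s h
        rw [map_one, one_mul]
      mul_smul := fun a b s ↦ funext fun h ↦ by
        change gg h.down (a * b) * s h = gg h.down a * (gg h.down b * s h)
        rw [map_mul, mul_assoc]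
      smul_zero := fun a ↦ funext fun h ↦ mul_zero _
      smul_add := fun a s t ↦ funext fun h ↦ mul_add _ _ _
      add_smul := fun a b s ↦ funext fun h ↦ by
        change gg h.down (a + b) * s h = gg h.down a * s h + gg h.down b * s h
        rw [map_add, add_mul]
      zero_smul := fun s ↦ funext fun h ↦ by
        change gg h.down 0 * s h = 0
        rw [map_zero, zero_mul] }
  res {U V} hVU :=
    { toFun := fun s h ↦ s ⟨hVU h.down⟩
      map_zero' := rfl
      map_add' := fun _ _ ↦ rfl }
  res_self _ := rfl
  res_res _ _ _ := rfl
  res_smul {U V} hVU a s := funext fun h ↦ by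
    change gg (hVU h.down) a * _ = gg h.down (rs hVU a) * _
    rw [gg_rs]
    rfl
  existsUnique_glue {ι} U s hs := by
    have key (i j : ι) (hi : genericPoint X ∈ U i) (hj : genericPoint X ∈ U j) :
        s i ⟨hi⟩ = s j ⟨hj⟩ := congrFun (hs i j) ⟨⟨hi, hj⟩⟩
    refine ⟨fun h ↦ s (Opens.mem_iSup.1 h.down).choose ⟨(Opens.mem_iSup.1 h.down).choose_spec⟩,
      fun i ↦ funext fun h ↦ key _ _ _ _, fun t ht ↦ funext fun h ↦ ?_⟩
    have := congrFun (ht (Opens.mem_iSup.1 h.down).choose) ⟨(Opens.mem_iSup.1 h.down).choose_spec⟩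
    exact this

/-- The constant sheaf of rational functions. -/
def ratSheaf : X.Modules := (ratData X).toModules

variable {X}

/-- The value of a section of the constant sheaf of rational functions. -/
def ratVal {W : X.Opens} (h : genericPoint X ∈ W) : Γ(ratSheaf X, W) →+ X.functionField where
  toFun s := (show (ratData X).sec W from s) ⟨h⟩
  map_zero' := rfl
  map_add' _ _ := rfl

lemma ratVal_smul {W : X.Opens} (h : genericPoint X ∈ W) (a : Γ(X, W)) (s : Γ(ratSheaf X, W)) :
    ratVal h (a • s) = gg h a * ratVal h s := rfl

/-- Sections of the constant sheaf of rational functions. -/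
def ratMk (W : X.Opens) (s : genericPoint X ∈ W → X.functionField) : Γ(ratSheaf X, W) :=
  show (ratData X).sec W from fun h ↦ s h.down

lemma ratVal_ratMk {W : X.Opens} (h : genericPoint X ∈ W) (s : genericPoint X ∈ W → X.functionField) :
    ratVal h (ratMk W s) = s h := rfl

lemma ratVal_rm {U V : X.Opens} (hVU : V ≤ U) (h : genericPoint X ∈ V) (s : Γ(ratSheaf X, U)) :
    ratVal h (rm _ hVU s) = ratVal (hVU h) s := rfl

lemma rat_ext {W : X.Opens} {s t : Γ(ratSheaf X, W)}
    (hst : ∀ h : genericPoint X ∈ W, ratVal h s = ratVal h t) : s = t :=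
  funext (α := PLift (genericPoint X ∈ W)) (β := fun _ ↦ X.functionField) fun h ↦ hst h.down

end Sky

/-! ### Contracting the connection with a derivation of the function field -/

section Contraction

variable [IrreducibleSpace X]

/-- Contracting `P ⊗ Ω_f` with a coordinate of `P` at the generic point and a derivation of the
function field. -/
lemma exists_contraction (f : X ⟶ Y) {P : X.Modules} {ι : Type*} [Fintype ι] {U : X.Opens}
    {e : ι → Γ(P, U)} (he : IsBasisOn P e) (hU : genericPoint X ∈ U) (i : ι)
    (δ : Derivation ℤ X.functionField X.functionField)
    (hδ : ∀ (W : Y.Opens) (h : genericPoint X ∈ f ⁻¹ᵁ W) (b : Γ(Y, W)),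
      δ (gg h (f.app W b)) = 0) :
    ∃ ψ : tensor P (relativeDifferentials f) ⟶ ratSheaf X,
      ∀ (W : X.Opens) (hW : W ≤ U) (h : genericPoint X ∈ W) (m : Γ(P, W)) (b : Γ(X, W)),
        ratVal h (ψ.app W (tm _ _ W m (dd f W b))) = gg h (he.coeff hW m i) * δ (gg h b) := by
  obtain ⟨α, hα⟩ := exists_differentials_hom f (N := ratSheaf X)
    (fun W ↦
      { toFun := fun b ↦ ratMk W fun h ↦ δ (gg h b)
        map_zero' := rat_ext fun h ↦ by
          refine (ratVal_ratMk h _).trans ?_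
          rw [map_zero, map_zero, map_zero]
        map_add' := fun a b ↦ rat_ext fun h ↦ by
          rw [map_add, ratVal_ratMk, ratVal_ratMk, ratVal_ratMk, map_add, map_add] })
    (fun W a b ↦ rat_ext fun h ↦ by
      rw [map_add, ratVal_smul, ratVal_smul]
      change δ (gg h (a * b)) = gg h a * δ (gg h b) + gg h b * δ (gg h a)
      rw [map_mul, δ.leibniz]
      rfl)
    (fun V W hWV a ↦ rat_ext fun h ↦ by
      rw [ratVal_rm]
      change δ (gg h (rs hWV a)) = δ (gg _ a)
      rw [gg_rs])
    (fun W b ↦ rat_ext fun h ↦ by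
      exact (hδ W h b).trans (map_zero (ratVal h)).symm)
  -- The `i`-th coordinate is a function only over `W ⊓ U`, but it has a value in the function field
  -- for every nonempty `W`, which makes the contraction a morphism on all of `X`.
  let c (W : X.Opens) (h : genericPoint X ∈ W) : Γ(P, W) → X.functionField := fun m ↦
    gg (Opens.mem_inf.2 ⟨h, hU⟩) (he.coeff inf_le_right (rm P inf_le_left m) i)
  have c_add (W h) (m m' : Γ(P, W)) : c W h (m + m') = c W h m + c W h m' := by
    simp only [c, map_add, Pi.add_apply (M := fun _ ↦ Γ(X, W ⊓ U))]
  have c_smul (W h) (a : Γ(X, W)) (m : Γ(P, W)) : c W h (a • m) = gg h a * c W h m := by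
    simp only [c, map_smulₛₗ, RingHom.id_apply, Pi.smul_apply (M := fun _ ↦ Γ(X, W ⊓ U)), smul_eq_mul,
      map_mul, gg_rs]
  have c_rm (V W : X.Opens) (hWV : W ≤ V) (h) (m : Γ(P, V)) :
      c W h (rm P hWV m) = c V (hWV h) m := by
    have := he.coeff_rm (inf_le_right : V ⊓ U ≤ U) (inf_le_inf_right U hWV) (rm P inf_le_left m)
    simp only [c]
    rw [← gg_rs (inf_le_inf_right U hWV) (Opens.mem_inf.2 ⟨h, hU⟩), ← congrFun this i, rm_rm, rm_rm]
  obtain ⟨ψ, hψ⟩ := exists_tensor_hom (M := P) (N := relativeDifferentials f) (K := ratSheaf X)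
    (fun W ↦ LinearMap.mk₂ Γ(X, W) (fun m ω ↦ ratMk W fun h ↦ c W h m * ratVal h (α.app W ω))
      (fun m m' ω ↦ rat_ext (W := W) fun h ↦ by
        refine Eq.trans ?_ (map_add (ratVal h) _ _).symm
        change c W h (m + m') * _ = c W h m * ratVal h (α.app W ω) + c W h m' * ratVal h (α.app W ω)
        rw [c_add W h, add_mul])
      (fun a m ω ↦ rat_ext fun h ↦ by
        refine Eq.trans ?_ (ratVal_smul h a _).symm
        change c W h (a • m) * _ = _ * (c W h m * _)
        rw [c_smul, mul_assoc])
      (fun m ω ω' ↦ rat_ext fun h ↦ by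
        refine Eq.trans ?_ (map_add (ratVal h) _ _).symm
        change c W h m * ratVal h (α.app W (ω + ω')) = c W h m * ratVal h _ + c W h m * ratVal h _
        rw [map_add, map_add, mul_add])
      (fun a m ω ↦ rat_ext fun h ↦ by
        refine Eq.trans ?_ (ratVal_smul h a _).symm
        change c W h m * ratVal h (α.app W (a • ω)) = _ * (c W h m * ratVal h _)
        have : α.app W (a • ω) = a • α.app W ω := Scheme.Modules.Hom.app_smul α a ω
        rw [this, ratVal_smul, mul_left_comm]))
    (fun V W hWV m ω ↦ rat_ext fun h ↦ by
      refine Eq.trans ?_ (ratVal_rm hWV h _).symm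
      change c W h (rm P hWV m) * ratVal h (α.app W (rm _ hWV ω)) =
        c V (hWV h) m * ratVal (hWV h) (α.app V ω)
      exact congrArg₂ (· * ·) (c_rm V W hWV h m) (congrArg (ratVal h) (app_rm α hWV ω)))
  refine ⟨ψ, fun W hW h m b ↦ ?_⟩
  rw [hψ]
  change c W h m * ratVal h (α.app W (dd f W b)) = _
  rw [hα]
  change c W h m * δ (gg h b) = _
  congr 1
  have := congrFun (he.coeff_rm hW (inf_le_left : W ⊓ U ≤ W) m) i
  simp only [c]
  rw [this, gg_rs]

/-- If a combination `∑ a_i e_i` of basis elements is horizontal for a connection which kills the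
`e_i`, then the `a_i` are killed by the derivations of the function field. -/
lemma derivation_coeff_eq_zero (f : X ⟶ Y) {P : X.Modules} {ι : Type*} [Fintype ι]
    {U : X.Opens} {e : ι → Γ(P, U)} (he : IsBasisOn P e)
    (D : ∀ W, Γ(P, W) →+ Γ(tensor P (relativeDifferentials f), W))
    (hD_rm : ∀ U V h x, D V (rm _ h x) = rm _ h (D U x))
    (hD_smul : ∀ W a x, D W (a • x) = a • D W x + tm _ _ W x (dd f W a))
    (hDe : ∀ i, D U (e i) = 0)
    (δ : Derivation ℤ X.functionField X.functionField)
    (hδ : ∀ (W : Y.Opens) (h : genericPoint X ∈ f ⁻¹ᵁ W) (b : Γ(Y, W)),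
      δ (gg h (f.app W b)) = 0)
    {W : X.Opens} (hW : W ≤ U) (h : genericPoint X ∈ W) (a : ι → Γ(X, W))
    (ha : D W (combination P e hW a) = 0) (i : ι) : δ (gg h (a i)) = 0 := by
  classical
  obtain ⟨ψ, hψ⟩ := exists_contraction f he (hW h) i δ hδ
  -- Since `D` kills the basis, `D (∑ a_j e_j) = ∑ e_j ⊗ da_j`; contracting with the `i`-th
  -- coordinate and `δ` leaves `δ a_i`.
  have key : D W (combination P e hW a) = ∑ j, tm _ _ W (rm P hW (e j)) (dd f W (a j)) := by
    rw [combination_apply, map_sum]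
    refine Finset.sum_congr rfl fun j _ ↦ ?_
    rw [hD_smul, hD_rm, hDe, map_zero, smul_zero, zero_add]
  rw [key] at ha
  have h2 := congrArg (fun s ↦ ratVal h (ψ.app W s)) ha
  simp only [map_sum, map_zero] at h2
  replace h2 := (Finset.sum_congr rfl fun j _ ↦ (hψ W hW h (rm P hW (e j)) (a j)).symm).trans h2
  rw [Finset.sum_eq_single i] at h2
  · rwa [he.coeff_basis, Pi.single_eq_same, map_one, one_mul] at h2
  · intro j _ hj
    rw [he.coeff_basis, Pi.single_eq_of_ne hj.symm, map_zero, zero_mul]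
  · simp

end Contraction

lemma pb_combination (f : X ⟶ Y) {M : Y.Modules} {ι : Type*} [Fintype ι] {U : Y.Opens}
    (e : ι → Γ(M, U)) {W : Y.Opens} (h : W ≤ U) (a : ι → Γ(Y, W)) :
    pb f M W (combination M e h a) = combination ((Scheme.Modules.pullback f).obj M)
      (fun i ↦ pb f M U (e i)) (f.preimage_mono h) (fun i ↦ f.app W (a i)) := by
  rw [combination_apply, combination_apply, map_sum]
  refine Finset.sum_congr rfl fun i _ ↦ ?_
  rw [map_smulₛₗ, pb_rm]

lemma exists_nbhd_basis {M : X.Modules} (hM : IsLocallyFree M) (W : X.Opens) (x : W) :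
    ∃ (V : X.Opens) (_ : V ≤ W) (_ : x.1 ∈ V) (n : ℕ) (e : Fin n → Γ(M, V)), IsBasisOn M e := by
  obtain ⟨U, hx, n, e, he⟩ := hM x
  refine ⟨U ⊓ W, inf_le_right, ⟨hx, x.2⟩, n, fun i ↦ rm M inf_le_left (e i), fun V hV ↦ ?_⟩
  have := he V (hV.trans inf_le_left)
  convert this using 1
  ext a
  simp only [combination_apply, rm_rm]

/-! ### Cartier's theorem on horizontal sections -/

section Frobenius

variable (p : ℕ) [Fact p.Prime] [IsIntegral X] (hp : (p : Γ(X, ⊤)) = 0)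

lemma gg_frobenius {W : X.Opens} (h : genericPoint X ∈ W) (b : Γ(X, W)) :
    gg (W := absoluteFrobenius p X hp ⁻¹ᵁ W) h ((absoluteFrobenius p X hp).app W b) = gg h b ^ p :=
  map_pow (gg h) b p

include hp in
lemma charP_functionField : CharP X.functionField p := by
  refine (CharP.charP_iff_prime_eq_zero Fact.out).mpr ?_
  have := congrArg (gg (W := ⊤) (X := X) trivial) hp
  rwa [map_natCast, map_zero] at this

lemma frobenius_app_injective {W : X.Opens} (h : genericPoint X ∈ W) :
    Function.Injective ((absoluteFrobenius p X hp).app W) := by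
  intro a b hab
  have := charP_functionField p hp
  apply gg_injective h
  apply frobenius_inj X.functionField p
  rw [frobenius_def, frobenius_def, ← gg_frobenius p hp h, ← gg_frobenius p hp h]
  exact congrArg (gg (W := absoluteFrobenius p X hp ⁻¹ᵁ W) h) hab

/-- In a local basis, Frobenius pull-back raises coordinates to the `p`-th power, which is injective
on functions of an integral scheme of characteristic `p`. -/
lemma pb_frobenius_injective {M : X.Modules} (hM : IsLocallyFree M) (W : X.Opens) :
    Function.Injective (pb (absoluteFrobenius p X hp) M W) := by
  rw [injective_iff_map_eq_zero]
  intro m hm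
  choose V hVW hx n e he using exists_nbhd_basis hM W
  refine eq_of_locally_eq M V W hVW (fun x hx' ↦ Opens.mem_iSup.2 ⟨⟨x, hx'⟩, hx ⟨x, hx'⟩⟩) _ _
    fun x ↦ ?_
  have h := pb_rm (absoluteFrobenius p X hp) M (hVW x) m
  rw [hm, map_zero, ← (he x).combination_coeff le_rfl (rm M (hVW x) m), pb_combination] at h
  have h2 := (((he x).pullback (absoluteFrobenius p X hp)) _ _).1 (h.trans (map_zero _).symm)
  have h3 : (he x).coeff le_rfl (rm M (hVW x) m) = 0 := by
    funext i
    apply frobenius_app_injective p hp (genericPoint_mem (hx x))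
    exact (congrFun h2 i).trans (map_zero _).symm
  rw [map_zero, ← (he x).combination_coeff le_rfl (rm M (hVW x) m), h3, map_zero]

/-- Cartier's theorem: on a normal scheme, the horizontal sections of the Frobenius pull-back of a
vector bundle are the pull-backs of sections. -/
lemma exists_pb_eq (hX : IsNormalScheme X) {M : X.Modules} (hM : IsLocallyFree M)
    (D : ∀ W, Γ((Scheme.Modules.pullback (absoluteFrobenius p X hp)).obj M, W) →+
      Γ(tensor ((Scheme.Modules.pullback (absoluteFrobenius p X hp)).obj M)
        (relativeDifferentials (absoluteFrobenius p X hp)), W))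
    (hD_rm : ∀ U V h x, D V (rm _ h x) = rm _ h (D U x))
    (hD_smul : ∀ W a x, D W (a • x) =
      a • D W x + tm _ _ W x (dd (absoluteFrobenius p X hp) W a))
    (hD_pb : ∀ U m, D (absoluteFrobenius p X hp ⁻¹ᵁ U) (pb _ M U m) = 0)
    (W : X.Opens) (x : Γ((Scheme.Modules.pullback (absoluteFrobenius p X hp)).obj M,
      absoluteFrobenius p X hp ⁻¹ᵁ W)) (hx : D _ x = 0) :
    ∃ m : Γ(M, W), pb (absoluteFrobenius p X hp) M W m = x := by
  have := charP_functionField p hp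
  let F := absoluteFrobenius p X hp
  choose V hVW hV n e he using exists_nbhd_basis hM W
  have hη (y : W) : genericPoint X ∈ V y := genericPoint_mem (hV y)
  have hloc (y : W) : ∃ m : Γ(M, V y), pb F M (V y) m = rm _ (F.preimage_mono (hVW y)) x := by
    have he' := (he y).pullback F
    obtain ⟨a, ha⟩ := (he' _ le_rfl).2 (rm _ (F.preimage_mono (hVW y)) x)
    have hb (i) : ∃ b : Γ(X, V y), F.app _ b = a i := by
      -- A coordinate that is not a `p`-th power in the function field would be moved by some
      -- derivation. In characteristic `p` any derivation kills `p`-th powers, hence the image of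
      -- Frobenius, so horizontality forbids this.
      obtain ⟨k, hk⟩ : ∃ k, k ^ p = gg (W := F ⁻¹ᵁ V y) (hη y) (a i) := by
        by_contra! h
        obtain ⟨δ, hδ⟩ := exists_derivation_ne_zero p h
        refine hδ (derivation_coeff_eq_zero F he' D hD_rm hD_smul (fun i ↦ hD_pb _ _) δ
          (fun U hU b ↦ ?_) le_rfl (hη y) a ?_ i)
        · have := gg_frobenius p hp hU b
          refine (congrArg δ this).trans ?_
          rw [δ.leibniz_pow, nsmul_eq_mul, CharP.cast_eq_zero, zero_mul]
        · rw [ha, hD_rm, hx, map_zero]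
      -- The root `k` is integral over each local ring since `k ^ p` is regular there; normality
      -- makes `k` itself regular.
      obtain ⟨b, hb⟩ := exists_gg_eq hX (hη y) k fun z hz ↦ by
        refine IsIntegral.of_pow (Fact.out : p.Prime).pos ?_
        rw [hk]
        have : Nonempty (V y) := ⟨z, hz⟩
        have h2 := Scheme.algebraMap_germ_eq_germToFunctionField (X := X) (U := V y) hz (a i)
        rw [show gg (W := F ⁻¹ᵁ V y) (hη y) (a i) = _ from h2.symm]
        exact isIntegral_algebraMap
      refine ⟨b, ?_⟩
      apply gg_injective (W := F ⁻¹ᵁ V y) (hη y)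
      rw [gg_frobenius p hp (hη y) b, hb, hk]
    choose b hb using hb
    refine ⟨combination M (e y) le_rfl b, ?_⟩
    rw [pb_combination, ← ha]
    exact congrArg _ (funext hb)
  choose m hm using hloc
  -- The local descents agree on overlaps because Frobenius pull-back is injective and they have the
  -- same image.
  obtain ⟨t, ht, -⟩ := existsUnique_glue M V W hVW
    (fun x hx' ↦ Opens.mem_iSup.2 ⟨⟨x, hx'⟩, hV ⟨x, hx'⟩⟩) m (fun y z ↦ by
      apply pb_frobenius_injective p hp hM
      rw [pb_rm, pb_rm]
      refine (congrArg _ (hm y)).trans (Eq.trans ?_ (congrArg _ (hm z)).symm)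
      rw [rm_rm, rm_rm])
  refine ⟨t, eq_of_locally_eq _ (fun y ↦ F ⁻¹ᵁ V y) _ (fun y ↦ F.preimage_mono (hVW y))
    (fun x hx' ↦ Opens.mem_iSup.2 ⟨⟨x, hx'⟩, hV ⟨x, hx'⟩⟩) _ _ fun y ↦ ?_⟩
  rw [← hm, ← ht, pb_rm]

end Frobenius

/-! ### Descending an extension of the unit through one Frobenius -/

/-- Morphisms from the constant sheaf `ℤ_X` to `G` correspond to global sections of `G`. -/
lemma constantZ_hom_eq_zero {G : AbSheaf X} (hG : Subsingleton (G.obj.obj (op ⊤)))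
    (t : constantZ X ⟶ G) : t = 0 := by
  apply ((constantSheafAdj (Opens.grothendieckTopology X) AddCommGrpCat.{u}
    (isTerminalTop : IsTerminal (⊤ : X.Opens))).homEquiv _ _).injective
  ext x
  exact hG.elim _ _

/-- A morphism of abelian sheaves from its action on sections. -/
def abMk {E G : AbSheaf X} (a : ∀ U : X.Opens, E.obj.obj (op U) →+ G.obj.obj (op U))
    (ha : ∀ (U V : X.Opens) (h : V ≤ U) (m : E.obj.obj (op U)),
      a V (E.obj.map (homOfLE h).op m) = G.obj.map (homOfLE h).op (a U m)) : E ⟶ G :=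
  ⟨{ app := fun U ↦ AddCommGrpCat.ofHom (a U.unop)
     naturality := fun U V f ↦ by
       ext m
       exact ha _ _ f.unop.le m }⟩

/-- If `F^* f^* M ⊗ Ω_F` has no global sections, extensions of the unit of `F ≫ f` along the kernel of
`E ⟶ ℤ` descend to extensions of the unit of `f`. -/
lemma UnitExtends.of_frobenius_comp (p : ℕ) [Fact p.Prime] [IsIntegral X]
    (hp : (p : Γ(X, ⊤)) = 0) (hX : IsNormalScheme X) (f : X ⟶ Z) {M : Z.Modules}
    (hM : IsLocallyFree ((Scheme.Modules.pullback f).obj M)) {E : AbSheaf Z} {i : toAbSheaf M ⟶ E}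
    {q : E ⟶ constantZ Z} {hz : i ≫ q = 0} (hS : (ShortComplex.mk i q hz).ShortExact)
    (h0 : Subsingleton Γ(tensor ((Scheme.Modules.pullback (absoluteFrobenius p X hp)).obj
      ((Scheme.Modules.pullback f).obj M)) (relativeDifferentials (absoluteFrobenius p X hp)), ⊤))
    (h : UnitExtends (absoluteFrobenius p X hp ≫ f) i) : UnitExtends f i := by
  let F := absoluteFrobenius p X hp
  let P := (Scheme.Modules.pullback f).obj M
  let N := (Scheme.Modules.pullback F).obj P
  let T := tensor N (relativeDifferentials F)
  obtain ⟨h, hh⟩ := (unitExtends_comp_iff F f i).1 h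
  obtain ⟨D, hD_rm, hD_smul, hD_pb⟩ := exists_connection F P
  let DAb : toAbSheaf N ⟶ toAbSheaf T := abMk D hD_rm
  let d : (directImage f).obj ((directImage F).obj (toAbSheaf N)) ⟶
      (directImage f).obj ((directImage F).obj (toAbSheaf T)) :=
    (directImage f).map ((directImage F).map DAb)
  have hd : i ≫ h ≫ d = 0 := by
    rw [reassoc_of% hh]
    ext U m
    exact hD_pb _ _
  have := hS.epi_g
  -- The composite kills `M`, so it factors through `E ⟶ ℤ`; the factor is given by a global section
  -- of `F^* f^* M ⊗ Ω_F` and vanishes by `h0`.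
  have hd0 : h ≫ d = 0 := by
    obtain ⟨t, ht⟩ : ∃ t, q ≫ t = h ≫ d :=
      ⟨hS.exact.desc (h ≫ d) hd, hS.exact.g_desc _ hd⟩
    rw [← ht, constantZ_hom_eq_zero (X := Z)
      (G := (directImage f).obj ((directImage F).obj (toAbSheaf T))) h0 t, comp_zero]
  let hsec (U : Z.Opens) : E.obj.obj (op U) →+ Γ(N, F ⁻¹ᵁ (f ⁻¹ᵁ U)) := (h.hom.app (op U)).hom
  have hD0 (U : Z.Opens) (x : E.obj.obj (op U)) : D _ (hsec U x) = 0 :=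
    congrArg (fun k : E ⟶ (directImage f).obj ((directImage F).obj (toAbSheaf T)) ↦
      (k.hom.app (op U)).hom x) hd0
  have hex (U : Z.Opens) (x : E.obj.obj (op U)) : ∃ m, pb F P (f ⁻¹ᵁ U) m = hsec U x :=
    exists_pb_eq p hp hX hM D hD_rm hD_smul hD_pb _ _ (hD0 U x)
  choose k hk using hex
  -- The lifts `k` are chosen section by section; injectivity makes them unique, hence additive,
  -- compatible with restriction and equal to the unit on `M`.
  have inj (U : Z.Opens) := pb_frobenius_injective p hp hM (f ⁻¹ᵁ U)
  refine ⟨abMk (G := (directImage f).obj (toAbSheaf P)) (fun U ↦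
    { toFun := k U
      map_zero' := inj U ((hk U 0).trans ((map_zero _).trans (map_zero (pb F P _)).symm))
      map_add' := fun x y ↦ inj U ((hk U _).trans
        ((map_add (hsec U) x y).trans ((congrArg₂ _ (hk U x) (hk U y)).symm.trans
          (map_add (pb F P _) _ _).symm))) })
    (fun U V hVU x ↦ inj V ?_), ?_⟩
  · refine (hk V _).trans (Eq.trans ?_ (pb_rm F P (f.preimage_mono hVU) (k U x)).symm)
    rw [hk]
    exact ConcreteCategory.congr_hom (h.hom.naturality (homOfLE hVU).op) x
  · ext U m
    refine inj U.unop ((hk U.unop _).trans ?_)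
    exact congrArg (fun k : toAbSheaf M ⟶ (directImage f).obj ((directImage F).obj (toAbSheaf N)) ↦
      (k.hom.app U).hom m) hh

/-! ### Values at the generic point and a uniform exponent -/

section GenericFibre

variable [IrreducibleSpace X]

/-- The value of a function at the generic point. -/
def genEv {V : X.Opens} (h : genericPoint X ∈ V) : Γ(X, V) →+* X.residueField (genericPoint X) :=
  (X.evaluation V _ h).hom

lemma genEv_rs {U V : X.Opens} (hVU : V ≤ U) (h : genericPoint X ∈ V) (a : Γ(X, U)) :
    genEv h (rs hVU a) = genEv (hVU h) a :=
  congrArg (X.residue (genericPoint X)) (X.presheaf.germ_res_apply (homOfLE hVU) _ h a)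

/-- The locus where `a - b` is invertible is open and misses the generic point, so it is empty.
Hence `a` and `b` have equal values at every point. This allows `X` to be non-reduced: generic
values determine functions only up to such differences, which basic opens do not see. -/
lemma basicOpen_eq_of_genEv {V : X.Opens} (h : genericPoint X ∈ V) (a b : Γ(X, V))
    (hab : genEv h a = genEv h b) : X.basicOpen a = X.basicOpen b := by
  have h0 : genEv h (a - b) = 0 := by rw [map_sub, hab, sub_self]
  have hbot : X.basicOpen (a - b) = ⊥ := by
    rw [eq_bot_iff]
    intro x hx
    exact ((X.evaluation_eq_zero_iff_notMem_basicOpen _ h _).1 h0 (genericPoint_mem hx)).elim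
  rw [Scheme.basicOpen_eq_bot_iff_forall_evaluation_eq_zero] at hbot
  ext x
  have key (hx : x ∈ V) : X.evaluation V x hx a = X.evaluation V x hx b := by
    rw [← sub_eq_zero, ← map_sub]
    exact hbot ⟨x, hx⟩
  constructor
  · intro hx
    have hxV := X.basicOpen_le a hx
    have := (X.evaluation_ne_zero_iff_mem_basicOpen x hxV a).2 hx
    exact (X.evaluation_ne_zero_iff_mem_basicOpen x hxV b).1 (key hxV ▸ this)
  · intro hx
    have hxV := X.basicOpen_le b hx
    have := (X.evaluation_ne_zero_iff_mem_basicOpen x hxV b).2 hx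
    exact (X.evaluation_ne_zero_iff_mem_basicOpen x hxV a).1 ((key hxV).symm ▸ this)

variable [IsIntegral Y] (f : X ⟶ Y) (hf : f (genericPoint X) = genericPoint Y)

lemma map_genericPoint [IsDominant f] : f (genericPoint X) = genericPoint Y := by
  refine (genericPoint_spec Y).eq ?_ |>.symm
  have h := (genericPoint_spec X).image f.continuous
  rwa [Set.image_univ, f.denseRange.closure_range] at h

/-- The homomorphism from the function field of `Y` to the residue field at the generic point of
`X`. -/
def genMap : Y.functionField →+* X.residueField (genericPoint X) :=
  (Y.presheaf.stalkSpecializes (specializes_of_eq hf) ≫ f.stalkMap (genericPoint X) ≫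
    X.residue (genericPoint X)).hom

lemma genMap_gg {W : Y.Opens} (hW : genericPoint Y ∈ W) (hW' : genericPoint X ∈ f ⁻¹ᵁ W)
    (a : Γ(Y, W)) : genMap f hf (gg hW a) = genEv hW' (f.app W a) := by
  have h1 := Y.presheaf.germ_stalkSpecializes_apply (U := W) hW (specializes_of_eq hf) a
  refine (congrArg (fun s ↦ X.residue _ (f.stalkMap _ s)) h1).trans ?_
  exact congrArg (X.residue _) (f.germ_stalkMap_apply W _ hW' a)

lemma exists_genMap_eq_pow (p : ℕ) [Fact p.Prime] (hp : (p : Γ(Y, ⊤)) = 0)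
    (h : IsGenericallyInseparable f) (l : X.residueField (genericPoint X)) :
    ∃ n k, genMap f hf k = l ^ p ^ n := by
  let := (f.residueFieldMap (genericPoint X)).hom.toAlgebra
  have : IsPurelyInseparable (Y.residueField (f (genericPoint X)))
    (X.residueField (genericPoint X)) := h.2
  have h0 : (p : Y.residueField (f (genericPoint X))) = 0 := by
    have := congrArg (Y.evaluation ⊤ (f (genericPoint X)) trivial).hom hp
    rwa [map_natCast, map_zero] at this
  have : CharP (Y.residueField (f (genericPoint X))) p :=
    (CharP.charP_iff_prime_eq_zero Fact.out).mpr h0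
  have : ExpChar (Y.residueField (f (genericPoint X))) p := .prime Fact.out
  obtain ⟨n, y, hy⟩ := IsPurelyInseparable.pow_mem (Y.residueField (f (genericPoint X))) p l
  obtain ⟨y, rfl⟩ := Y.residue_surjective _ y
  obtain ⟨k, rfl⟩ : ∃ k, Y.presheaf.stalkSpecializes (specializes_of_eq hf) k = y := by
    obtain ⟨U, hU, b, rfl⟩ := Y.presheaf.exists_germ_eq y
    exact ⟨gg (hf ▸ hU) b, Y.presheaf.germ_stalkSpecializes_apply _ _ b⟩
  refine ⟨n, k, hy ▸ ?_⟩
  exact (ConcreteCategory.congr_hom (Scheme.residue_residueFieldMap f (genericPoint X)) _).symm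

/-- The values whose `p ^ N`-th power comes from `Y` form a subfield `T N`, increasing with `N`.
Over an affine open of `Y` finitely many module generators suffice for all functions above it, so
one `N` works there. On any other open set, a function becomes after localisation a quotient of
functions from the affine one, and `T N` is closed under quotients. -/
lemma exists_exponent (p : ℕ) [Fact p.Prime] (hp : (p : Γ(Y, ⊤)) = 0) [IsFinite f]
    (h : IsGenericallyInseparable f) :
    ∃ N, ∀ (V : X.Opens) (hV : genericPoint X ∈ V) (b : Γ(X, V)),
      ∃ k, genMap f hf k = genEv hV b ^ p ^ N := by
  let L := X.residueField (genericPoint X)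
  have h0 : (p : L) = 0 := by
    have := congrArg ((genMap f hf).comp (gg (W := (⊤ : Y.Opens)) trivial)) hp
    rwa [map_natCast, map_zero] at this
  have : CharP L p := (CharP.charP_iff_prime_eq_zero Fact.out).mpr h0
  have : ExpChar L p := .prime Fact.out
  let T (N : ℕ) : Subfield L := (genMap f hf).fieldRange.comap (iterateFrobenius L p N)
  have hT (N) (l : L) : l ∈ T N ↔ ∃ k, genMap f hf k = l ^ p ^ N := by
    change iterateFrobenius L p N l ∈ (genMap f hf).fieldRange ↔ _
    rw [RingHom.mem_fieldRange, iterateFrobenius_def]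
  have hmono {M N : ℕ} (hMN : M ≤ N) : T M ≤ T N := by
    intro l hl
    obtain ⟨k, hk⟩ := (hT M l).1 hl
    refine (hT N l).2 ⟨k ^ p ^ (N - M), ?_⟩
    rw [map_pow, hk, ← pow_mul, ← pow_add, Nat.add_sub_cancel' hMN]
  obtain ⟨U, hU, hηU, -⟩ := Y.isBasis_affineOpens.exists_subset_of_mem_open
    (Set.mem_univ (genericPoint Y)) isOpen_univ
  obtain ⟨U, hUa, rfl⟩ := hU
  have hηV : genericPoint X ∈ f ⁻¹ᵁ U := by
    change f (genericPoint X) ∈ U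
    rw [hf]; exact hηU
  have hVa : IsAffineOpen (f ⁻¹ᵁ U) := IsAffineOpen.preimage hUa f
  obtain ⟨N, hN⟩ : ∃ N, ∀ b : Γ(X, f ⁻¹ᵁ U), genEv hηV b ∈ T N := by
    let := (f.app U).hom.toAlgebra
    have : Module.Finite Γ(Y, U) Γ(X, f ⁻¹ᵁ U) := IsFinite.finite_app f U hUa
    -- Each generator `s i` has its own exponent `e i`; their supremum serves all linear
    -- combinations.
    obtain ⟨n, s, hs⟩ := Module.Finite.exists_fin (R := Γ(Y, U)) (M := Γ(X, f ⁻¹ᵁ U))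
    choose e he using fun i ↦ exists_genMap_eq_pow f hf p hp h (genEv hηV (s i))
    refine ⟨Finset.univ.sup e, fun b ↦ ?_⟩
    have hb : b ∈ Submodule.span Γ(Y, U) (Set.range s) := hs ▸ Submodule.mem_top
    induction hb using Submodule.span_induction with
    | mem x hx =>
      obtain ⟨i, rfl⟩ := hx
      exact hmono (Finset.le_sup (Finset.mem_univ i)) ((hT _ _).2 (he i))
    | zero => rw [map_zero]; exact zero_mem _
    | add x y _ _ hx hy => rw [map_add]; exact add_mem hx hy
    | smul a x _ hx =>
      rw [Algebra.smul_def, map_mul]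
      refine mul_mem (hmono (Nat.zero_le _) ((hT _ _).2 ⟨gg hηU a, ?_⟩)) hx
      rw [pow_zero, pow_one]
      exact genMap_gg f hf hηU hηV a
  refine ⟨N, fun V hV b ↦ (hT _ _).1 ?_⟩
  -- On a basic open inside `V`, `b * s ^ n` is the restriction of a function on the affine open,
  -- and `s` is nonzero at the generic point.
  obtain ⟨s, hsV, hηs⟩ := hVa.exists_basicOpen_le ⟨_, hV⟩ hηV
  have := hVa.isLocalization_basicOpen s
  obtain ⟨n, t, ht⟩ := IsLocalization.Away.surj s (rs hsV b)
  have h2 := congrArg (genEv hηs) ht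
  have hs' (c) : genEv hηs (algebraMap Γ(X, f ⁻¹ᵁ U) Γ(X, X.basicOpen s) c) = genEv hηV c :=
    genEv_rs (X.basicOpen_le s) hηs c
  rw [map_mul, map_pow, hs', hs', genEv_rs] at h2
  have hs0 : genEv hηV s ≠ 0 := (X.evaluation_ne_zero_iff_mem_basicOpen _ hηV s).2 hηs
  rw [eq_div_of_mul_eq (pow_ne_zero n hs0) h2]
  exact div_mem (hN _) (pow_mem (hN _) _)

end GenericFibre

lemma subsingleton_sections [IrreducibleSpace X] {W : X.Opens} (hW : genericPoint X ∉ W) :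
    Subsingleton Γ(X, W) := by
  obtain rfl : W = ⊥ := by
    rw [eq_bot_iff]
    exact fun x hx ↦ (hW (genericPoint_mem hx)).elim
  infer_instance

/-! ### The power map from functions on the source to functions on the normal target -/

section PowerMap

variable [IrreducibleSpace X] [IsIntegral Y] (f : X ⟶ Y) (hf : f (genericPoint X) = genericPoint Y)

include hf in
lemma genericPoint_mem_preimage {W : Y.Opens} (hW : genericPoint Y ∈ W) :
    genericPoint X ∈ f ⁻¹ᵁ W := by
  change f (genericPoint X) ∈ W
  rwa [hf]

/-- If `f` is finite and `Y` is normal, powers of functions on `X` which are generically functions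
on `Y` come from functions on `Y`. -/
lemma exists_genMap_gg_eq [IsFinite f] (hY : IsNormalScheme Y) (n : ℕ) {W : Y.Opens}
    (hW : genericPoint Y ∈ W) (b : Γ(X, f ⁻¹ᵁ W)) {k : Y.functionField}
    (hk : genMap f hf k = genEv (genericPoint_mem_preimage f hf hW) b ^ n) :
    ∃ a : Γ(Y, W), genMap f hf (gg hW a) = genEv (genericPoint_mem_preimage f hf hW) b ^ n := by
  obtain ⟨a, rfl⟩ := exists_gg_eq hY hW k fun y hy ↦ by
    obtain ⟨_, ⟨U, hUa, rfl⟩, hyU, hUW⟩ := Y.isBasis_affineOpens.exists_subset_of_mem_open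
      hy W.isOpen
    have hηU : genericPoint Y ∈ U := genericPoint_mem hyU
    have hηU' := genericPoint_mem_preimage f hf hηU
    -- A monic equation for `b ^ n` over functions on `U` becomes one for `k`, because `genMap` is a
    -- field homomorphism and hence injective; normality then applies to `k`.
    obtain ⟨P, hP, hPb⟩ := IsIntegralHom.isIntegral_app f U hUa
      (rs (f.preimage_mono (show U ≤ W from hUW)) b ^ n)
    have h1 : P.eval₂ ((genMap f hf).comp (gg hηU)) (genMap f hf k) = 0 := by
      have := congrArg (genEv hηU') hPb
      rw [Polynomial.hom_eval₂, map_zero, map_pow, genEv_rs] at this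
      rw [hk, ← this]
      congr 1
      exact RingHom.ext fun a ↦ genMap_gg f hf hηU hηU' a
    rw [← Polynomial.hom_eval₂, map_eq_zero] at h1
    have : Nonempty U := ⟨y, hyU⟩
    refine ⟨P.map (Y.presheaf.germ U y hyU).hom, hP.map _, ?_⟩
    rw [Polynomial.eval₂_map, ← h1]
    congr 1
    exact RingHom.ext fun a ↦ Scheme.algebraMap_germ_eq_germToFunctionField (X := Y) hyU a
  exact ⟨a, hk⟩

/-- The homomorphism `ψ` such that `ψ (f^# a) = a ^ q` and `f^# (ψ b) = b ^ q` modulo nilpotents. -/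
lemma exists_powerMap (p : ℕ) [Fact p.Prime] (hp : (p : Γ(Y, ⊤)) = 0) [IsFinite f]
    (hY : IsNormalScheme Y) (N : ℕ)
    (hN : ∀ (V : X.Opens) (hV : genericPoint X ∈ V) (b : Γ(X, V)),
      ∃ k, genMap f hf k = genEv hV b ^ p ^ N) :
    ∃ ψ : ∀ W : Y.Opens, Γ(X, f ⁻¹ᵁ W) →+* Γ(Y, W),
      ∀ (W : Y.Opens) (hW : genericPoint Y ∈ W) (b : Γ(X, f ⁻¹ᵁ W)),
        genMap f hf (gg hW (ψ W b)) = genEv (genericPoint_mem_preimage f hf hW) b ^ p ^ N := by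
  let L := X.residueField (genericPoint X)
  have h0 : (p : L) = 0 := by
    have := congrArg ((genMap f hf).comp (gg (W := (⊤ : Y.Opens)) trivial)) hp
    rwa [map_natCast, map_zero] at this
  have : CharP L p := (CharP.charP_iff_prime_eq_zero Fact.out).mpr h0
  have : ExpChar L p := .prime Fact.out
  have hex (W : Y.Opens) : ∃ ψ : Γ(X, f ⁻¹ᵁ W) →+* Γ(Y, W),
      ∀ (hW : genericPoint Y ∈ W) (b : Γ(X, f ⁻¹ᵁ W)),
        genMap f hf (gg hW (ψ b)) = genEv (genericPoint_mem_preimage f hf hW) b ^ p ^ N := by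
    by_cases hW : genericPoint Y ∈ W
    · have hW' := genericPoint_mem_preimage f hf hW
      choose ψ hψ using fun b ↦ (hN _ hW' b).elim fun k hk ↦ exists_genMap_gg_eq f hf hY _ hW b hk
      -- The ring homomorphism axioms are checked in `L`, where the `p ^ N`-th power map is
      -- additive.
      have inj : Function.Injective ((genMap f hf).comp (gg hW)) :=
        (genMap f hf).injective.comp (gg_injective hW)
      refine ⟨
        { toFun := ψ
          map_one' := inj ?_
          map_zero' := inj ?_
          map_mul' := fun a b ↦ inj ?_
          map_add' := fun a b ↦ inj ?_ }, fun _ b ↦ hψ b⟩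
      · exact (hψ 1).trans (by rw [map_one, map_one, one_pow])
      · exact (hψ _).trans (by
          rw [map_mul, map_mul, mul_pow]
          exact congrArg₂ _ (hψ a).symm (hψ b).symm)
      · exact (hψ 0).trans (by
          rw [map_zero, map_zero, zero_pow (pow_ne_zero _ (Fact.out : p.Prime).ne_zero)])
      · exact (hψ _).trans (by
          rw [map_add, map_add, add_pow_expChar_pow]
          exact congrArg₂ _ (hψ a).symm (hψ b).symm)
    · have := subsingleton_sections hW
      exact ⟨
        { toFun := fun _ ↦ 0
          map_one' := Subsingleton.elim _ _
          map_zero' := rfl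
          map_mul' := fun _ _ ↦ Subsingleton.elim _ _
          map_add' := fun _ _ ↦ Subsingleton.elim _ _ }, fun h ↦ (hW h).elim⟩
  choose ψ hψ using hex
  exact ⟨ψ, hψ⟩

variable {n : ℕ} (ψ : ∀ W : Y.Opens, Γ(X, f ⁻¹ᵁ W) →+* Γ(Y, W))
  (hψ : ∀ (W : Y.Opens) (hW : genericPoint Y ∈ W) (b : Γ(X, f ⁻¹ᵁ W)),
    genMap f hf (gg hW (ψ W b)) = genEv (genericPoint_mem_preimage f hf hW) b ^ n)

include hψ

lemma rs_powerMap (U V : Y.Opens) (hVU : V ≤ U) (b : Γ(X, f ⁻¹ᵁ U)) :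
    rs hVU (ψ U b) = ψ V (rs (f.preimage_mono hVU) b) := by
  by_cases hV : genericPoint Y ∈ V
  · apply gg_injective hV
    apply (genMap f hf).injective
    rw [gg_rs, hψ, hψ, genEv_rs]
  · have := subsingleton_sections hV
    exact Subsingleton.elim _ _

lemma powerMap_app (W : Y.Opens) (a : Γ(Y, W)) : ψ W (f.app W a) = a ^ n := by
  by_cases hW : genericPoint Y ∈ W
  · apply gg_injective hW
    apply (genMap f hf).injective
    rw [hψ, map_pow, map_pow, genMap_gg f hf hW (genericPoint_mem_preimage f hf hW)]
  · have := subsingleton_sections hW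
    exact Subsingleton.elim _ _

/-- The functions `f^# (ψ b)` and `b ^ n` have the same value at the generic point, hence the same
basic open, and that of `b ^ n` is that of `b`. Thus basic opens of the source are preimages of
opens of the target. -/
lemma preimage_basicOpen_powerMap (hn : 0 < n) (W : Y.Opens) (b : Γ(X, f ⁻¹ᵁ W)) :
    f ⁻¹ᵁ Y.basicOpen (ψ W b) = X.basicOpen b := by
  by_cases hW : genericPoint Y ∈ W
  · have hW' := genericPoint_mem_preimage f hf hW
    rw [Scheme.preimage_basicOpen, ← X.basicOpen_pow b hn]
    apply basicOpen_eq_of_genEv hW'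
    rw [← genMap_gg f hf hW, hψ, map_pow]
  · obtain rfl : W = ⊥ := by
      rw [eq_bot_iff]
      exact fun x hx ↦ (hW (genericPoint_mem hx)).elim
    refine le_antisymm (fun x hx ↦ ?_) (fun x hx ↦ ?_)
    · exact (Y.basicOpen_le _ hx).elim
    · exact (show False from X.basicOpen_le _ hx).elim

/-- Basic opens above affine opens of `Y` are preimages of opens, so `f` is inducing, and injective
since schemes are `T₀`. Surjectivity holds because `f` is closed and dominant. -/
lemma isHomeomorph_of_powerMap (hn : 0 < n) [IsFinite f] [IsDominant f] : IsHomeomorph f := by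
  have hind : Topology.IsInducing f := by
    refine ⟨le_antisymm f.continuous.le_induced fun V hV ↦ ?_⟩
    let V : X.Opens := ⟨V, hV⟩
    refine isOpen_induced_iff.2 ⟨⋃₀ {O | IsOpen O ∧ f ⁻¹' O ⊆ V}, isOpen_sUnion fun O hO ↦ hO.1,
      subset_antisymm ?_ fun x hx ↦ ?_⟩
    · rintro x ⟨O, hO, hx⟩
      exact hO.2 hx
    · obtain ⟨_, ⟨U, hUa, rfl⟩, hxU, -⟩ := Y.isBasis_affineOpens.exists_subset_of_mem_open
        (Set.mem_univ (f x)) isOpen_univ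
      obtain ⟨s, hsV, hxs⟩ := (IsAffineOpen.preimage hUa f).exists_basicOpen_le (V := V) ⟨x, hx⟩ hxU
      rw [← preimage_basicOpen_powerMap f hf ψ hψ hn] at hsV hxs
      exact ⟨_, ⟨(Y.basicOpen _).isOpen, hsV⟩, hxs⟩
  have hsurj : Function.Surjective f := by
    rw [← Set.range_eq_univ, ← f.isClosedMap.isClosed_range.closure_eq, f.denseRange.closure_range]
  exact ((Equiv.ofBijective f ⟨hind.injective, hsurj⟩).toHomeomorphOfIsInducing hind).isHomeomorph

end PowerMap

/-- The morphism of schemes with underlying map the inverse `σ` of `f`, and with prescribed action on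
functions. -/
def sectionMk (f : X ⟶ Y) (σ : Y → X) (hσc : Continuous σ) (hσ : ∀ x, σ (f x) = x)
    (hσ' : ∀ y, f (σ y) = y)
    (ψ : ∀ W : Y.Opens, Γ(X, f ⁻¹ᵁ W) →+* Γ(Y, W))
    (h_rs : ∀ (U V : Y.Opens) (hVU : V ≤ U) (b : Γ(X, f ⁻¹ᵁ U)),
      rs hVU (ψ U b) = ψ V (rs (f.preimage_mono hVU) b))
    (h_basicOpen : ∀ (W : Y.Opens) (b : Γ(X, f ⁻¹ᵁ W)),
      f ⁻¹ᵁ Y.basicOpen (ψ W b) = X.basicOpen b) : Y ⟶ X where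
  base := TopCat.ofHom ⟨σ, hσc⟩
  c :=
    { app := fun V ↦ CommRingCat.ofHom ((ψ ⟨σ ⁻¹' V.unop, V.unop.isOpen.preimage hσc⟩).comp
        (rs (fun x (hx : σ (f x) ∈ V.unop) ↦ hσ x ▸ hx)))
      naturality := fun U V i ↦ by
        ext b
        refine (congrArg (ψ _) ?_).trans (h_rs _ _ (fun x hx ↦ i.unop.le hx) _).symm
        exact (rs_rs _ _ _).trans (rs_rs _ _ _).symm }
  prop y := by
    refine ⟨fun a ha ↦ ?_⟩
    obtain ⟨V, hV, s, rfl⟩ := X.presheaf.exists_germ_eq a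
    rw [PresheafedSpace.stalkMap_germ_apply] at ha
    let W : Y.Opens := ⟨σ ⁻¹' V, V.isOpen.preimage hσc⟩
    have hW : f ⁻¹ᵁ W ≤ V := fun x (hx : σ (f x) ∈ V) ↦ hσ x ▸ hx
    -- Locality on stalks: invertibility of `ψ s` at `y` is translated by `h_basicOpen` into
    -- invertibility of `s` at `σ y`.
    have hy : y ∈ Y.basicOpen (ψ W (rs hW s)) := (Y.mem_basicOpen _ y hV).2 ha
    have hy' : σ y ∈ f ⁻¹ᵁ Y.basicOpen (ψ W (rs hW s)) := by
      change f (σ y) ∈ Y.basicOpen (ψ W (rs hW s))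
      rwa [hσ']
    rw [h_basicOpen, rs, Scheme.basicOpen_res] at hy'
    exact (X.mem_basicOpen s _ hV).1 hy'.2

/-! ### Iterated Frobenius and factorisation through the finite morphism -/

lemma iteratedFrobenius_apply (p : ℕ) [Fact p.Prime] (hp : (p : Γ(X, ⊤)) = 0) (n : ℕ) (x : X) :
    iteratedFrobenius p X hp n x = x := by
  induction n with
  | zero => rfl
  | succ n ih => exact ih

lemma gg_iteratedFrobenius [IsIntegral X] (p : ℕ) [Fact p.Prime] (hp : (p : Γ(X, ⊤)) = 0) (n : ℕ)
    {W : X.Opens} (hW : genericPoint X ∈ W) (hW' : genericPoint X ∈ iteratedFrobenius p X hp n ⁻¹ᵁ W)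
    (a : Γ(X, W)) : gg hW' ((iteratedFrobenius p X hp n).app W a) = gg hW a ^ p ^ n := by
  induction n generalizing W with
  | zero => rw [pow_zero, pow_one]; rfl
  | succ n ih =>
    refine (ih (W := absoluteFrobenius p X hp ⁻¹ᵁ W) hW hW' ((absoluteFrobenius p X hp).app W a)).trans ?_
    rw [gg_frobenius p hp hW, ← pow_mul, pow_succ']

/-- A finite generically inseparable morphism to a normal scheme is dominated by an iterate of the
Frobenius endomorphism. -/
theorem exists_comp_eq_iteratedFrobenius [IsIntegral Y] [IrreducibleSpace X] (p : ℕ) [Fact p.Prime]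
    (hp : (p : Γ(Y, ⊤)) = 0) (hY : IsNormalScheme Y) (f : X ⟶ Y) [IsFinite f]
    (h : IsGenericallyInseparable f) : ∃ (N : ℕ) (g : Y ⟶ X), g ≫ f = iteratedFrobenius p Y hp N := by
  have := h.isDominant
  have hf := map_genericPoint f
  obtain ⟨N, hN⟩ := exists_exponent f hf p hp h
  obtain ⟨ψ, hψ⟩ := exists_powerMap f hf p hp hY N hN
  have hn : 0 < p ^ N := pow_pos (Fact.out : p.Prime).pos N
  let e := (isHomeomorph_of_powerMap f hf ψ hψ hn).homeomorph
  let g : Y ⟶ X := sectionMk f e.symm e.symm.continuous e.symm_apply_apply e.apply_symm_apply ψ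
    (rs_powerMap f hf ψ hψ) (preimage_basicOpen_powerMap f hf ψ hψ hn)
  have hfg (y : Y) : (g ≫ f) y = y := e.apply_symm_apply y
  refine ⟨N, g, Scheme.Hom.ext ?_ fun W ↦ ?_⟩
  · ext y
    exact (hfg y).trans (iteratedFrobenius_apply p hp N y).symm
  · ext a
    by_cases hW : genericPoint Y ∈ W
    · have h1 : genericPoint Y ∈ iteratedFrobenius p Y hp N ⁻¹ᵁ W := by
        change iteratedFrobenius p Y hp N _ ∈ W
        rwa [iteratedFrobenius_apply]
      have h2 : genericPoint Y ∈ (g ≫ f) ⁻¹ᵁ W := by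
        change (g ≫ f) _ ∈ W
        rwa [hfg]
      apply gg_injective h1
      rw [gg_iteratedFrobenius p hp N hW]
      refine (Y.presheaf.germ_res_apply _ _ h1 _).trans ?_
      have hle : (g ≫ f) ⁻¹ᵁ W ≤ W := fun y (hy : (g ≫ f) y ∈ W) ↦ hfg y ▸ hy
      -- By construction `g` acts on functions through `ψ`, so `g ≫ f` sends `a` to `ψ (f^# a) = a ^
      -- p ^ N`, as does the iterated Frobenius.
      have h3 : (g ≫ f).app W a = rs hle (ψ W (f.app W a)) :=
        (rs_powerMap f hf ψ hψ _ _ hle _).symm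
      rw [powerMap_app f hf ψ hψ] at h3
      refine (congrArg (gg h2) h3).trans ?_
      rw [gg_rs, map_pow]
    · have : Subsingleton Γ(Y, iteratedFrobenius p Y hp N ⁻¹ᵁ W) := by
        apply subsingleton_sections
        change iteratedFrobenius p Y hp N _ ∉ W
        rwa [iteratedFrobenius_apply]
      exact Subsingleton.elim _ _

lemma iteratedFrobenius_add (p : ℕ) [Fact p.Prime] (hp : (p : Γ(X, ⊤)) = 0) (m n : ℕ) :
    iteratedFrobenius p X hp (m + n) = iteratedFrobenius p X hp m ≫ iteratedFrobenius p X hp n := by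
  induction n with
  | zero => exact (Category.comp_id _).symm
  | succ n ih =>
    change iteratedFrobenius p X hp (m + n) ≫ _ = _ ≫ _ ≫ _
    rw [ih, Category.assoc]

lemma iteratedFrobenius_one (p : ℕ) [Fact p.Prime] (hp : (p : Γ(X, ⊤)) = 0) :
    iteratedFrobenius p X hp 1 = absoluteFrobenius p X hp :=
  Category.id_comp _

/-- The definition appends the new Frobenius on the target side; descent has to remove it on the
source side. -/
lemma iteratedFrobenius_succ' (p : ℕ) [Fact p.Prime] (hp : (p : Γ(X, ⊤)) = 0) (n : ℕ) :
    iteratedFrobenius p X hp (n + 1) = absoluteFrobenius p X hp ≫ iteratedFrobenius p X hp n := by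
  rw [add_comm, iteratedFrobenius_add, iteratedFrobenius_one]

/-- The pull-back of an iterated Frobenius pull-back. -/
def pullbackFrobeniusIso (p : ℕ) [Fact p.Prime] (hp : (p : Γ(X, ⊤)) = 0) (M : X.Modules) (m n : ℕ) :
    (Scheme.Modules.pullback (absoluteFrobenius p X hp)).obj
      ((Scheme.Modules.pullback (iteratedFrobenius p X hp m)).obj
        ((Scheme.Modules.pullback (iteratedFrobenius p X hp n)).obj M)) ≅
      (Scheme.Modules.pullback (iteratedFrobenius p X hp (m + 1 + n))).obj M :=
  (Scheme.Modules.pullbackComp _ _).app _ ≪≫ (Scheme.Modules.pullbackComp _ _).app M ≪≫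
    (Scheme.Modules.pullbackCongr (by
      rw [iteratedFrobenius_add, iteratedFrobenius_succ'])).app M

lemma subsingleton_sections_of_iso {M N : X.Modules} (e : M ≅ N) (U : X.Opens)
    [Subsingleton Γ(N, U)] : Subsingleton Γ(M, U) := by
  refine ⟨fun a b ↦ ?_⟩
  have h (c : Γ(M, U)) : e.inv.app U (e.hom.app U c) = c :=
    congrArg (fun k : M ⟶ M ↦ k.app U c) e.hom_inv_id
  rw [← h a, ← h b, Subsingleton.elim (e.hom.app U a) (e.hom.app U b)]

end FrobeniusPullback

end

/-! ### The injectivity theorem -/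

theorem corollary2p4 (p : ℕ) [Fact p.Prime] (k₀ : Type u) [Field k₀] [CharP k₀ p]
    (S : Scheme.{u}) [IsIntegral S] (π : S ⟶ Spec (.of k₀)) (hπ : IsProjectiveOver π)
    (hS : IsNormalScheme S) (V : S.Modules) (hV : IsAmpleBundle V) (n₀ : ℕ)
    (hn₀ : ∀ n : ℕ, n₀ < n → Subsingleton
      Γ(tensor
        ((Scheme.Modules.pullback
          (iteratedFrobenius p S (natCast_eq_zero_of_hom p π) n)).obj (dual V))
        (relativeDifferentials (absoluteFrobenius p S (natCast_eq_zero_of_hom p π))), ⊤))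
    (S' : Scheme.{u}) [IrreducibleSpace S'] (φ : S' ⟶ S) [IsFinite φ]
    (hφ : IsGenericallyInseparable φ) :
    Function.Injective
      (cohomologyPullback φ
        ((Scheme.Modules.pullback
          (iteratedFrobenius p S (natCast_eq_zero_of_hom p π) n₀)).obj (dual V)) 1) := by
  rw [injective_iff_map_eq_zero]
  intro c hc
  have hp := natCast_eq_zero_of_hom p π
  obtain ⟨E, i, q, hz, hE, rfl⟩ := exists_extClass_eq c
  obtain ⟨N, g, hg⟩ := exists_comp_eq_iteratedFrobenius p hp hS φ hφ
  -- Vanishing on `S'` implies extension of the unit for `φ`, and then for `g ≫ φ`, which is an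
  -- iterate of Frobenius on `S`.
  have hN := (unitExtends_of_cohomologyPullback_eq_zero φ _ i q hz hE hc).comp g
  rw [hg] at hN
  have hfree := (hV.isVectorBundle.isLocallyFree.dual).pullback (iteratedFrobenius p S hp n₀)
  have descend (k : ℕ) (hk : UnitExtends (iteratedFrobenius p S hp (k + 1)) i) :
      UnitExtends (iteratedFrobenius p S hp k) i := by
    rw [iteratedFrobenius_succ'] at hk
    refine hk.of_frobenius_comp p hp hS _ (hfree.pullback _) hE ?_
    -- The bundle is already an `n₀`-fold Frobenius pull-back, so removing the `(k+1)`-st Frobenius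
    -- involves the exponent `k + 1 + n₀`, which exceeds `n₀` even at the last step `k = 0`.
    have := hn₀ (k + 1 + n₀) (by lia)
    exact subsingleton_sections_of_iso (tensorIso (pullbackFrobeniusIso p hp _ k n₀) _) ⊤
  have h0 : UnitExtends (iteratedFrobenius p S hp 0) i := by
    clear hg
    induction N with
    | zero => exact hN
    | succ N ih => exact ih (descend N hN)
  obtain ⟨r, hr⟩ := UnitExtends.exists_retraction h0
  exact extClass_eq_zero_of_retraction hE r hr
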